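/- **Extension Theorem.** Let $K$ be a commutative non-Archimedean Banach ring (a commutative unital ring complete for a norm with $\|ab\|\le\|a\|\|b\|$ and $\|a+b\|\le\max(\|a\|,\|b\|)$) that is torsion free as an abelian group, and let $V$ be a torsion free Banach $K$-module: a $K$-module complete for a norm with $\|cv\|\le\|c\|\|v\|$ and $\|u+v\|\le\max(\|u\|,\|v\|)$, torsion free as an abelian group, and such that $cv=0$ with $c\in K$, $v\in V$ implies $c=0$ or $v=0$. *Notation.* $\mathrm{End}(V)$ is the algebra of bounded $K$-linear operators on $V$ with the operator norm. $\mathrm{End}(V)[[z^{\pm1}]]$ is the $K$-module of series $a(z)=\sum_{n\in\mathbf Z}a_{(n)}z^{-n-1}$ with $a_{(n)}\in\mathrm{End}(V)$ and $\|a(z)\|=\sup_n\|a_{(n)}\|<\infty$, and similarly $\mathrm{End}(V)[[z^{\pm1},w^{\pm1}]]$ with the supremum norm. A *field* is an $a(z)\in\mathrm{End}(V)[[z^{\pm1}]]$ with $a_{(n)}v\to0$ as $n\to+\infty$ for every $v\in V$; the fields form the $K$-module $\mathrm{End}(V)\langle\langle z\rangle\rangle$, which carries the induced norm, and $I_V$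 is the identity operator seen as a constant field. Two fields are *mutually local* if $(z-w)^N[a(z),b(w)]\to0$ in $\mathrm{End}(V)[[z^{\pm1},w^{\pm1}]]$ as $N\to\infty$. A field is *translation covariant* with respect to $T\in\mathrm{End}(V)$ if $[T,a(z)]=\partial_za(z)$. For $m\ge0$, $\partial_z^{(m)}$ is the operator $z^k\mapsto\binom km z^{k-m}$. The *$n$-th product* of two fields is $a(w)_{(n)}b(w)=\mathrm{Res}_z\big((z-w)^n[a(z),b(w)]\big)$ for $n\ge0$ and $a(z)_{(-m-1)}b(z)={:}(\partial_z^{(m)}a(z))\,b(z){:}$ for $m\ge0$, where ${:}a(z)b(z){:}=a(z)_+b(z)+b(z)a(z)_-$ with $a(z)_+=\sum_{n\le-1}a_{(n)}z^{-n-1}$, $a(z)_-=\sum_{n\ge0}a_{(n)}z^{-n-1}$ (the coefficients of these products are sums that converge at each vector). The *$K$-saturation* of a $K$-submodule $U\subset V$ is $\{v\in V: \lambda v\in U\text{ for some nonzero }\lambda\in K\}$. A *vertex $K$-algebra structure* on $V$ consists of a vector $|0\rangle\in V$, an operator $T\in\mathrm{End}(V)$ with $T|0\rangle=0$, and a closed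 $K$-submodule $\mathrm{Fld}(V)\subset\mathrm{End}(V)\langle\langle z\rangle\rangle$ containing $I_V$, such that: (V.1) $\varphi(z)|0\rangle\in V[[z]]$ for all $\varphi(z)\in\mathrm{Fld}(V)$; (V.2) all $\varphi(z)\in\mathrm{Fld}(V)$ are translation covariant with respect to $T$; (V.3) any two elements of $\mathrm{Fld}(V)$ are mutually local; (V.4) $\mathrm{Fld}(V)$ is preserved by all $n$-th products, $n\in\mathbf Z$; (V.5) the $K$-saturation of $\{\varphi_{(-1)}|0\rangle:\varphi(z)\in\mathrm{Fld}(V)\}$ is dense in $V$. *Theorem.* Let $|0\rangle\in V$, let $T\in\mathrm{End}(V)$, and let $\mathcal F=\{a^j(z)\}_{j\in J}$ be a family of fields in $\mathrm{End}(V)\langle\langle z\rangle\rangle$. Let $V_{\mathcal F}$ be the smallest $K$-submodule of $V$ that contains $|0\rangle$ and is preserved by all $a^j_{(n)}$, $j\in J$, $n\in\mathbf Z$. Suppose that - (E.1) $T|0\rangle=0$, and $a^j(z)|0\rangle\in V[[z]]$ for all $j\in J$; - (E.2) $[T,a^j(z)]=\partial_za^j(z)$ for all $j\in J$; - (E.3)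 $a^i(z)$ and $a^j(z)$ are mutually local for all $i,j\in J$ (including $i=j$); - (E.4) the $K$-saturation of $V_{\mathcal F}$ is dense in $V$. Then there is a vertex $K$-algebra structure on $V$, with vacuum vector $|0\rangle$ and translation operator $T$, in which $\mathrm{Fld}(V)$ is the closed $K$-submodule of $\mathrm{End}(V)\langle\langle z\rangle\rangle$ generated by $\mathcal F$, that is, the closure of the smallest $K$-submodule of $\mathrm{End}(V)\langle\langle z\rangle\rangle$ that contains $\mathcal F\cup\{I_V\}$ and is preserved by all $n$-th products, $n\in\mathbf Z$. -/

import Mathlib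

open Filter Topology

noncomputable section

namespace NonArchVertex

section BoundedEndomorphisms

variable (K V : Type*) [NormedCommRing K] [NormedAddCommGroup V] [Module K V] [IsBoundedSMul K V]

/-- The `K`-algebra of bounded `K`-linear operators `V → V`; the product is composition. -/
def bddEnd : Subalgebra K (Module.End K V) where
  carrier := {T | ∃ C : ℝ, 0 < C ∧ ∀ u, ‖T u‖ ≤ C * ‖u‖}
  mul_mem' := by
    rintro S T ⟨C, hC, hS⟩ ⟨D, hD, hT⟩
    refine ⟨C * D, mul_pos hC hD, fun u => ?_⟩
    calc ‖S (T u)‖ ≤ C * ‖T u‖ := hS _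
      _ ≤ C * (D * ‖u‖) := mul_le_mul_of_nonneg_left (hT u) hC.le
      _ = C * D * ‖u‖ := by ring
  add_mem' := by
    rintro S T ⟨C, hC, hS⟩ ⟨D, hD, hT⟩
    refine ⟨C + D, add_pos hC hD, fun u => ?_⟩
    calc ‖S u + T u‖ ≤ ‖S u‖ + ‖T u‖ := norm_add_le _ _
      _ ≤ C * ‖u‖ + D * ‖u‖ := add_le_add (hS u) (hT u)
      _ = (C + D) * ‖u‖ := by ring
  algebraMap_mem' := by
    intro c
    refine ⟨‖c‖ + 1, by positivity, fun u => ?_⟩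
    have h : ‖c • u‖ ≤ ‖c‖ * ‖u‖ := norm_smul_le c u
    have h' : (algebraMap K (Module.End K V) c) u = c • u := rfl
    rw [h']
    nlinarith [norm_nonneg u]

/-- `End(V)`, the bounded `K`-linear operators on `V`. -/
abbrev BddEnd : Type _ := ↥(bddEnd K V)

variable {K V}

/-- The operator norm: the infimum of all `C ≥ 0` with `‖T u‖ ≤ C ‖u‖` for all `u`. -/
def opNorm (T : BddEnd K V) : ℝ := sInf {C : ℝ | 0 ≤ C ∧ ∀ u, ‖T.1 u‖ ≤ C * ‖u‖}

theorem opNorm_set_bddBelow (T : BddEnd K V) :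
    BddBelow {C : ℝ | 0 ≤ C ∧ ∀ u, ‖T.1 u‖ ≤ C * ‖u‖} := ⟨0, fun _ h => h.1⟩

theorem opNorm_set_nonempty (T : BddEnd K V) :
    {C : ℝ | 0 ≤ C ∧ ∀ u, ‖T.1 u‖ ≤ C * ‖u‖}.Nonempty := by
  obtain ⟨C, hC, h⟩ := T.2
  exact ⟨C, hC.le, h⟩

theorem opNorm_nonneg (T : BddEnd K V) : 0 ≤ opNorm T :=
  le_csInf (opNorm_set_nonempty T) fun _ h => h.1

theorem opNorm_le {T : BddEnd K V} {C : ℝ} (hC : 0 ≤ C) (h : ∀ u, ‖T.1 u‖ ≤ C * ‖u‖) :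
    opNorm T ≤ C := csInf_le (opNorm_set_bddBelow T) ⟨hC, h⟩

theorem le_opNorm (T : BddEnd K V) (u : V) : ‖T.1 u‖ ≤ opNorm T * ‖u‖ := by
  rcases eq_or_ne u 0 with rfl | hu
  · simp
  · have hu' : 0 < ‖u‖ := norm_pos_iff.mpr hu
    rw [← div_le_iff₀ hu']
    exact le_csInf (opNorm_set_nonempty T) fun C h => (div_le_iff₀ hu').mpr (h.2 u)

instance instNormedAddCommGroupBddEnd : NormedAddCommGroup (BddEnd K V) :=
  AddGroupNorm.toNormedAddCommGroup
    { toFun := opNorm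
      map_zero' := le_antisymm (opNorm_le le_rfl fun u => by simp) (opNorm_nonneg _)
      add_le' := fun S T => opNorm_le (add_nonneg (opNorm_nonneg S) (opNorm_nonneg T)) fun u => by
        calc ‖S.1 u + T.1 u‖ ≤ ‖S.1 u‖ + ‖T.1 u‖ := norm_add_le _ _
          _ ≤ opNorm S * ‖u‖ + opNorm T * ‖u‖ := add_le_add (le_opNorm S u) (le_opNorm T u)
          _ = (opNorm S + opNorm T) * ‖u‖ := by ring
      neg' := fun S => by
        unfold opNorm
        congr 1
        ext C
        simp
      eq_zero_of_map_eq_zero' := fun S hS => by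
        apply Subtype.ext
        ext u
        have h := le_opNorm S u
        rw [show opNorm S = 0 from hS, zero_mul] at h
        simpa using h }

theorem norm_apply_le (T : BddEnd K V) (u : V) : ‖T.1 u‖ ≤ ‖T‖ * ‖u‖ := le_opNorm T u

theorem norm_le_of_forall {T : BddEnd K V} {C : ℝ} (hC : 0 ≤ C)
    (h : ∀ u, ‖T.1 u‖ ≤ C * ‖u‖) : ‖T‖ ≤ C := opNorm_le hC h

instance instIsBoundedSMulBddEnd : IsBoundedSMul K (BddEnd K V) :=
  IsBoundedSMul.of_norm_smul_le fun c T =>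
    norm_le_of_forall (mul_nonneg (norm_nonneg c) (norm_nonneg T)) fun u => by
      calc ‖c • T.1 u‖ ≤ ‖c‖ * ‖T.1 u‖ := norm_smul_le _ _
        _ ≤ ‖c‖ * (‖T‖ * ‖u‖) := mul_le_mul_of_nonneg_left (norm_apply_le T u) (norm_nonneg c)
        _ = ‖c‖ * ‖T‖ * ‖u‖ := by ring

end BoundedEndomorphisms

section Fields

variable (K V : Type*) [NormedCommRing K] [NormedAddCommGroup V] [Module K V] [IsBoundedSMul K V]

/-- `End(V)[[z^{±1}]]`: bilateral series with bounded coefficients and the supremum norm.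
The value of `a` at `n` is `a_(n)`, the coefficient of `z^(-n-1)`. -/
abbrev Distr : Type _ := ↥(lp (fun _ : ℤ => BddEnd K V) ⊤)

/-- The fields: the formal distributions `a(z)` such that, for every vector `v`,
`a_(n) v → 0` as `n → +∞`. -/
def fields : Submodule K (Distr K V) where
  carrier := {a | ∀ v : V, Tendsto (fun n : ℤ => (a n).1 v) atTop (𝓝 0)}
  zero_mem' := fun v => by simp
  add_mem' := fun {a b} ha hb v => by
    have h := (ha v).add (hb v)
    rw [add_zero] at h
    exact h
  smul_mem' := fun c a ha v => by
    have h := (ha v).const_smul c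
    rw [smul_zero] at h
    exact h

/-- `End(V)⟨⟨z⟩⟩`, the space of fields, with the norm induced from `End(V)[[z^{±1}]]`. -/
abbrev QField : Type _ := ↥(fields K V)

variable {K V}

/-- `a_(n)`, the coefficient of `z^(-n-1)` in the field `a(z)`. -/
def QField.coeff (a : QField K V) (n : ℤ) : BddEnd K V := a.1 n

theorem QField.norm_coeff_apply_le (a : QField K V) (n : ℤ) (v : V) :
    ‖(a.coeff n).1 v‖ ≤ ‖a‖ * ‖v‖ :=
  (norm_apply_le _ _).trans <| mul_le_mul_of_nonneg_right
    (lp.norm_apply_le_norm ENNReal.top_ne_zero a.1 n) (norm_nonneg v)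

theorem QField.tendsto_coeff_apply (a : QField K V) (v : V) :
    Tendsto (fun n : ℤ => (a.coeff n).1 v) atTop (𝓝 0) := a.2 v

/-- A field from its coefficients. -/
def QField.mk' (a : ℤ → Module.End K V) (C : ℝ) (hC : 0 < C) (h : ∀ n v, ‖a n v‖ ≤ C * ‖v‖)
    (h0 : ∀ v, Tendsto (fun n : ℤ => a n v) atTop (𝓝 0)) : QField K V :=
  ⟨⟨fun n => ⟨a n, C, hC, h n⟩, memℓp_infty ⟨C, by
    rintro _ ⟨n, rfl⟩
    exact norm_le_of_forall hC.le (h n)⟩⟩, h0⟩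

variable (K V) in
/-- The identity operator `I_V`, as a constant field: its coefficient at `z^0` is `1`. -/
def idField : QField K V :=
  QField.mk' (fun n => if n = -1 then 1 else 0) 1 one_pos
    (fun n v => by by_cases h : n = -1 <;> simp [h])
    (fun v => by
      refine tendsto_const_nhds.congr' ?_
      filter_upwards [eventually_ge_atTop (0 : ℤ)] with n hn
      rw [if_neg (by omega)]
      rfl)

/-- The coefficients of the commutator `[a(z), b(w)]` in `End(V)[[z^{±1}, w^{±1}]]`;
the pair `(m, n)` stands for `z^(-m-1) w^(-n-1)`. -/
def comm (a b : QField K V) : ℤ × ℤ → BddEnd K V :=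
  fun p => ⁅a.coeff p.1, b.coeff p.2⁆

/-- Multiplication by `z - w` of a series in `z` and `w`, in the same indexing. -/
def mulZSubW (F : ℤ × ℤ → BddEnd K V) : ℤ × ℤ → BddEnd K V :=
  fun p => F (p.1 + 1, p.2) - F (p.1, p.2 + 1)

/-- `a(z)` and `b(z)` are mutually local: `(z-w)^N [a(z), b(w)] → 0` as `N → ∞` in the supremum
norm of `End(V)[[z^{±1}, w^{±1}]]`. -/
def MutuallyLocal (a b : QField K V) : Prop :=
  TendstoUniformly (fun N : ℕ => mulZSubW^[N] (comm a b)) 0 atTop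

theorem norm_coeff_coeff_apply_le (a b : QField K V) (m n : ℤ) (v : V) :
    ‖(a.coeff m).1 ((b.coeff n).1 v)‖ ≤ ‖a‖ * ‖b‖ * ‖v‖ := by
  rw [mul_assoc]
  exact (a.norm_coeff_apply_le m _).trans
    (mul_le_mul_of_nonneg_left (b.norm_coeff_apply_le n v) (norm_nonneg a))

theorem comm_apply (a b : QField K V) (p : ℤ × ℤ) (v : V) :
    (comm a b p).1 v
      = (a.coeff p.1).1 ((b.coeff p.2).1 v) - (b.coeff p.2).1 ((a.coeff p.1).1 v) := rfl

end Fields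

section NthProducts

variable {K V : Type*} [NormedCommRing K] [NormedAddCommGroup V] [Module K V] [IsBoundedSMul K V]
  [IsUltrametricDist V]

theorem norm_sub_le_of_le {x y : V} {C : ℝ} (hx : ‖x‖ ≤ C) (hy : ‖y‖ ≤ C) : ‖x - y‖ ≤ C := by
  rw [sub_eq_add_neg]
  refine (IsUltrametricDist.norm_add_le_max x (-y)).trans (max_le hx ?_)
  rwa [norm_neg]

theorem norm_add_le_of_le {x y : V} {C : ℝ} (hx : ‖x‖ ≤ C) (hy : ‖y‖ ≤ C) : ‖x + y‖ ≤ C :=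
  (IsUltrametricDist.norm_add_le_max x y).trans (max_le hx hy)

theorem iterate_mulZSubW_norm_le (a b : QField K V) (N : ℕ) :
    ∀ p v, ‖((mulZSubW^[N] (comm a b)) p).1 v‖ ≤ ‖a‖ * ‖b‖ * ‖v‖ := by
  induction N with
  | zero =>
    intro p v
    refine norm_sub_le_of_le (norm_coeff_coeff_apply_le a b _ _ v) ?_
    rw [mul_comm ‖a‖]
    exact norm_coeff_coeff_apply_le b a _ _ v
  | succ N ih =>
    intro p v
    rw [Function.iterate_succ_apply']
    exact norm_sub_le_of_le (ih _ v) (ih _ v)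

theorem iterate_mulZSubW_tendsto (a b : QField K V) (v : V) (N : ℕ) :
    ∀ m : ℤ, Tendsto (fun n : ℤ => ((mulZSubW^[N] (comm a b)) (m, n)).1 v) atTop (𝓝 0) := by
  induction N with
  | zero =>
    intro m
    have h1 : Tendsto (fun n : ℤ => (a.coeff m).1 ((b.coeff n).1 v)) atTop (𝓝 0) := by
      have h := (b.tendsto_coeff_apply v).norm.const_mul ‖a‖
      rw [norm_zero, mul_zero] at h
      exact squeeze_zero_norm (fun n => a.norm_coeff_apply_le m _) h
    have h := h1.sub (b.tendsto_coeff_apply ((a.coeff m).1 v))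
    rw [sub_zero] at h
    exact h
  | succ N ih =>
    intro m
    have h := (ih (m + 1)).sub ((ih m).comp (tendsto_atTop_add_const_right atTop (1 : ℤ) tendsto_id))
    rw [sub_zero] at h
    simp only [Function.iterate_succ_apply']
    exact h

/-- The `n`-th product for `n ≥ 0`: `a(w)_(n) b(w) = Res_z ((z-w)^n [a(z), b(w)])`. The residue in
`z`, the coefficient of `z^(-1)`, has first index `0`. -/
def resProd (a b : QField K V) (n : ℕ) : QField K V :=
  QField.mk' (fun p => ((mulZSubW^[n] (comm a b)) (0, p)).1) (‖a‖ * ‖b‖ + 1) (by positivity)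
    (fun p v => (iterate_mulZSubW_norm_le a b n (0, p) v).trans
      (mul_le_mul_of_nonneg_right (le_add_of_nonneg_right zero_le_one) (norm_nonneg v)))
    (fun v => iterate_mulZSubW_tendsto a b v n 0)

/-- The divided derivative `∂_z^{(m)}`, sending `z^k` to `(k choose m) z^(k-m)`: the coefficient of
the result at `z^(-n-1)` is `((m-n-1) choose m) a_(n-m)`. -/
def divDeriv (m : ℕ) (a : QField K V) : QField K V :=
  have hle : ∀ (n : ℤ) (v : V), ‖Ring.choose ((m : ℤ) - n - 1) m • (a.coeff (n - m)).1 v‖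
      ≤ ‖(a.coeff (n - m)).1 v‖ := fun n v => IsUltrametricDist.norm_zsmul_le _ _
  QField.mk' (fun n => Ring.choose ((m : ℤ) - n - 1) m • (a.coeff (n - m)).1) (‖a‖ + 1)
    (by positivity)
    (fun n v => (hle n v).trans <| (a.norm_coeff_apply_le _ v).trans
      (mul_le_mul_of_nonneg_right (le_add_of_nonneg_right zero_le_one) (norm_nonneg v)))
    (fun v => squeeze_zero_norm (hle · v) <| by
      have h := ((a.tendsto_coeff_apply v).comp
        (tendsto_atTop_add_const_right atTop (-(m : ℤ)) tendsto_id)).norm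
      rw [norm_zero] at h
      exact h)

variable [CompleteSpace V]

theorem summable_of_tendsto_zero {f : ℕ → V} (h : Tendsto f atTop (𝓝 0)) : Summable f :=
  NonarchimedeanAddGroup.summable_of_tendsto_cofinite_zero (by rwa [Nat.cofinite_eq_atTop])

theorem tendsto_intCast_add (p : ℤ) : Tendsto (fun j : ℕ => p + (j : ℤ)) atTop atTop :=
  tendsto_atTop_add_const_left atTop p tendsto_natCast_atTop_atTop

theorem normal_summable_left (a b : QField K V) (p : ℤ) (v : V) :
    Summable fun j : ℕ => (a.coeff (-1 - j)).1 ((b.coeff (p + j)).1 v) := by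
  refine summable_of_tendsto_zero ?_
  have h := ((b.tendsto_coeff_apply v).comp (tendsto_intCast_add p)).norm.const_mul ‖a‖
  rw [norm_zero, mul_zero] at h
  exact squeeze_zero_norm (fun n => a.norm_coeff_apply_le _ _) h

theorem normal_summable_right (a b : QField K V) (p : ℤ) (v : V) :
    Summable fun j : ℕ => (b.coeff (p - 1 - j)).1 ((a.coeff j).1 v) := by
  refine summable_of_tendsto_zero ?_
  have h := ((a.tendsto_coeff_apply v).comp tendsto_natCast_atTop_atTop).norm.const_mul ‖b‖
  rw [norm_zero, mul_zero] at h
  exact squeeze_zero_norm (fun n => b.norm_coeff_apply_le _ _) h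

/-- The coefficient of `:a(z)b(z): = a(z)_+ b(z) + b(z) a(z)_-` at `z^(-p-1)`: the sum of
`a_(m) b_(n)` over `m + n = p - 1`, `m ≤ -1`, plus the sum of `b_(n) a_(m)` over `m + n = p - 1`,
`m ≥ 0`. Both sums converge at each vector. -/
def normalCoeff (a b : QField K V) (p : ℤ) : Module.End K V where
  toFun v := ∑' j : ℕ, (a.coeff (-1 - j)).1 ((b.coeff (p + j)).1 v)
    + ∑' j : ℕ, (b.coeff (p - 1 - j)).1 ((a.coeff j).1 v)
  map_add' u v := by
    simp only [map_add]
    rw [(normal_summable_left a b p u).tsum_add (normal_summable_left a b p v),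
      (normal_summable_right a b p u).tsum_add (normal_summable_right a b p v)]
    abel
  map_smul' c v := by
    simp only [map_smul, RingHom.id_apply]
    rw [(normal_summable_left a b p v).tsum_const_smul,
      (normal_summable_right a b p v).tsum_const_smul, smul_add]

theorem normalCoeff_norm_le (a b : QField K V) (p : ℤ) (v : V) :
    ‖normalCoeff a b p v‖ ≤ ‖a‖ * ‖b‖ * ‖v‖ := by
  refine norm_add_le_of_le
    (IsUltrametricDist.norm_tsum_le_of_forall_le fun j => norm_coeff_coeff_apply_le a b _ _ v)
    (IsUltrametricDist.norm_tsum_le_of_forall_le fun j => ?_)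
  rw [mul_comm ‖a‖]
  exact norm_coeff_coeff_apply_le b a _ _ v

theorem normalCoeff_tendsto (a b : QField K V) (v : V) :
    Tendsto (fun p : ℤ => normalCoeff a b p v) atTop (𝓝 0) := by
  rw [Metric.tendsto_atTop]
  intro ε hε
  have key : ∀ c : ℝ, 0 ≤ c → ∃ δ : ℝ, 0 < δ ∧ c * δ ≤ ε / 2 := fun c hc => by
    refine ⟨ε / (2 * (c + 1)), by positivity, ?_⟩
    rw [mul_div_assoc', div_le_div_iff₀ (by positivity) (by positivity)]
    nlinarith
  obtain ⟨δ, hδ, hδa⟩ := key ‖a‖ (norm_nonneg a)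
  obtain ⟨η, hη, hηb⟩ := key ‖b‖ (norm_nonneg b)
  obtain ⟨P, hP⟩ := Metric.tendsto_atTop.mp (b.tendsto_coeff_apply v) δ hδ
  obtain ⟨M, hM⟩ := Metric.tendsto_atTop.mp (a.tendsto_coeff_apply v) η hη
  have hfin : ∀ᶠ p : ℤ in atTop, ∀ j ∈ Finset.range M.toNat,
      ‖(b.coeff (p - 1 - j)).1 ((a.coeff j).1 v)‖ < ε / 2 := by
    rw [Filter.eventually_all_finset]
    intro j _
    have h := (b.tendsto_coeff_apply ((a.coeff j).1 v)).comp
      (tendsto_atTop_add_const_right atTop (-1 - (j : ℤ)) tendsto_id)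
    filter_upwards [Metric.tendsto_nhds.mp h (ε / 2) (by positivity)] with p hp
    rw [dist_zero_right] at hp
    simpa [add_sub_assoc, sub_eq_add_neg, add_assoc] using hp
  obtain ⟨Q, hQ⟩ := Filter.eventually_atTop.mp hfin
  refine ⟨max P Q, fun p hp => ?_⟩
  rw [dist_zero_right]
  refine lt_of_le_of_lt (b := ε / 2) (norm_add_le_of_le
    (IsUltrametricDist.norm_tsum_le_of_forall_le fun j => ?_)
    (IsUltrametricDist.norm_tsum_le_of_forall_le fun j => ?_)) (by linarith)
  · have h := hP (p + j) (by have := le_trans (le_max_left P Q) hp; omega)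
    rw [dist_zero_right] at h
    exact (a.norm_coeff_apply_le _ _).trans
      ((mul_le_mul_of_nonneg_left h.le (norm_nonneg a)).trans hδa)
  · by_cases hj : j < M.toNat
    · exact (hQ p (le_trans (le_max_right P Q) hp) j (Finset.mem_range.mpr hj)).le
    · have h := hM j (by omega)
      rw [dist_zero_right] at h
      exact (b.norm_coeff_apply_le _ _).trans
        ((mul_le_mul_of_nonneg_left h.le (norm_nonneg b)).trans hηb)

/-- The normally ordered product `:a(z)b(z):`. -/
def normalProd (a b : QField K V) : QField K V :=
  QField.mk' (normalCoeff a b) (‖a‖ * ‖b‖ + 1) (by positivity)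
    (fun p v => (normalCoeff_norm_le a b p v).trans
      (mul_le_mul_of_nonneg_right (le_add_of_nonneg_right zero_le_one) (norm_nonneg v)))
    (normalCoeff_tendsto a b)

/-- The `n`-th product `a(z)_(n) b(z)` for every integer `n`; for `n = -m-1 < 0` it is
`:(∂_z^{(m)} a(z)) b(z):`. -/
def nthProd (a b : QField K V) : ℤ → QField K V
  | Int.ofNat n => resProd a b n
  | Int.negSucc m => normalProd (divDeriv m a) b

/-- The `K`-submodule of the space of fields generated by a family of fields: the smallest one that
contains the family and `I_V` and is preserved by all `n`-th products. -/
def generatedFields {J : Type*} (a : J → QField K V) : Submodule K (QField K V) :=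
  sInf {S | (∀ j, a j ∈ S) ∧ idField K V ∈ S ∧ ∀ φ ∈ S, ∀ ψ ∈ S, ∀ n : ℤ, nthProd φ ψ n ∈ S}

end NthProducts

section VertexAlgebras

variable {K V : Type*} [NormedCommRing K] [NormedAddCommGroup V] [Module K V] [IsBoundedSMul K V]

/-- `a(z) v ∈ V[[z]]`. -/
def IsRegularAt (a : QField K V) (v : V) : Prop := ∀ n : ℤ, 0 ≤ n → (a.coeff n).1 v = 0

/-- `a(z)` is translation covariant with respect to `T`: `[T, a(z)] = ∂_z a(z)`. -/
def TranslationCovariant [IsUltrametricDist V] (T : BddEnd K V) (a : QField K V) : Prop :=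
  ∀ n : ℤ, ⁅T, a.coeff n⁆ = (divDeriv 1 a).coeff n

/-- The `K`-saturation of a submodule. -/
def saturation (S : Submodule K V) : Set V := {v | ∃ c : K, c ≠ 0 ∧ c • v ∈ S}

/-- The map `φ(z) ↦ φ_(-1) |0⟩`. -/
def fieldState (vac : V) : QField K V →ₗ[K] V where
  toFun φ := (φ.coeff (-1)).1 vac
  map_add' _ _ := rfl
  map_smul' _ _ := rfl

/-- `V_F`, for a family `F` of fields: the smallest `K`-submodule of `V` that contains the vacuum
vector and is preserved by all coefficients of all members of the family. -/
def generatedStates {J : Type*} (a : J → QField K V) (vac : V) : Submodule K V :=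
  sInf {S | vac ∈ S ∧ ∀ (j : J) (n : ℤ), ∀ v ∈ S, ((a j).coeff n).1 v ∈ S}

variable (K V) in
/-- The structure of a vertex `K`-algebra on the Banach `K`-module `V`. -/
structure VertexAlgebra [IsUltrametricDist K] [CompleteSpace K] [IsUltrametricDist V]
    [CompleteSpace V] where
  ring_torsionFree : IsAddTorsionFree K
  add_torsionFree : IsAddTorsionFree V
  torsionFree : ∀ (c : K) (v : V), c • v = 0 → c = 0 ∨ v = 0
  /-- the vacuum vector -/
  vac : V
  /-- the translation operator -/
  T : BddEnd K V
  T_vac : T.1 vac = 0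
  /-- the space of fields -/
  fld : Submodule K (QField K V)
  fld_closed : IsClosed (fld : Set (QField K V))
  id_mem : idField K V ∈ fld
  vacuum : ∀ φ ∈ fld, IsRegularAt φ vac
  translation : ∀ φ ∈ fld, TranslationCovariant T φ
  locality : ∀ φ ∈ fld, ∀ ψ ∈ fld, MutuallyLocal φ ψ
  nthProd_mem : ∀ φ ∈ fld, ∀ ψ ∈ fld, ∀ n : ℤ, nthProd φ ψ n ∈ fld
  completeness : Dense (saturation (fld.map (fieldState vac)))

end VertexAlgebras

end NonArchVertex

end

/-!
Almost all axioms hold for the generated fields because each of them cuts out a closed submodule of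
the space of fields that contains the family and `I_V` and is preserved by all `n`-th products; such a
submodule contains the closed submodule generated by the family (`closure_generatedFields_le`).

All products are treated together through one formula (`nthProd_coeff_apply`), valid for every
integer `n`:
`a(w)_(n) b(w) = Res_z (a(z) b(w) i_{|z|>|w|} (z-w)^n - b(w) a(z) i_{|w|>|z|} (z-w)^n)`.
Its coefficients are sums of null sequences against the integers `(-1)^j (n choose j)`, which have
norm at most one as operators since `V` is ultrametric; hence the products are jointly continuous
(`continuous_nthProd`) and preserve the closure of the generated submodule. Regularity at the vacuum
is immediate from the formula, and translation covariance follows from it by a telescoping series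
(`altSum_euler`).

Locality is the main point. The non-Archimedean Dong lemma (`MutuallyLocal.nthProd_left`) expands
powers of `w - x = (z - x) - (z - w)`: in every term of a high power, the exponent of `z - x` or that
of `z - w` is large, and either makes the term small, because residues do not increase norms. The
lemma asks that all three fields be pairwise local, so it cannot be applied to one generated field at
a time. It is applied to the bicommutant of the family (`localClosure`), whose members are pairwise
local from the start.

For the density axiom, `(a_(n) φ)_(-1)|0⟩ = a_(n) (φ_(-1)|0⟩)` (`fieldState_nthProd`), so the
vectors `φ_(-1)|0⟩` form a submodule that contains `|0⟩` and is preserved by all coefficients of the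
family; thus it contains the submodule whose saturation is dense by assumption.
-/

namespace NonArchVertex

theorem multichoose_neg_add_one (n : ℤ) (j : ℕ) :
    Ring.multichoose (-(n + 1)) (j + 1)
      = Ring.multichoose (-n) (j + 1) - Ring.multichoose (-n) j := by
  have h := Ring.multichoose_succ_succ (-(n + 1)) j
  rw [show -(n + 1) + 1 = -n by ring] at h
  rw [h, add_sub_cancel_right]

theorem succ_mul_multichoose (r : ℤ) (j : ℕ) :
    ((j : ℤ) + 1) * Ring.multichoose r (j + 1) = (r + j) * Ring.multichoose r j := by
  have h2 := Ring.factorial_nsmul_multichoose_eq_ascPochhammer r (j + 1)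
  rw [ascPochhammer_succ_right, Polynomial.smeval_mul,
    ← Ring.factorial_nsmul_multichoose_eq_ascPochhammer r j, Nat.factorial_succ] at h2
  simp only [nsmul_eq_mul, Polynomial.smeval_add, Polynomial.smeval_X, pow_one,
    Polynomial.smeval_natCast, pow_zero, mul_one] at h2
  apply mul_left_cancel₀ (show ((j.factorial : ℕ) : ℤ) ≠ 0 by exact_mod_cast j.factorial_ne_zero)
  push_cast at h2
  linear_combination h2

theorem multichoose_natCast_add_one (m j : ℕ) :
    Ring.multichoose ((m : ℤ) + 1) j = ((m + j).choose m : ℕ) := by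
  rw [Ring.multichoose_eq, show (m : ℤ) + 1 + j - 1 = ((m + j : ℕ) : ℤ) by push_cast; ring,
    Ring.choose_natCast, Nat.choose_symm_add]

/-! ### Sums against the coefficients of `(1 - x)^n` -/

section AltSum

variable {V : Type*} [NormedAddCommGroup V]

/-- The sum of `f j` against the coefficient of `x^j` in `(1 - x)^n`. That coefficient is
`(-1)^j (n choose j)`, which is the multichoose number of `-n`. For a null
sequence `f` the sum converges. -/
noncomputable def altSum (n : ℤ) (f : ℕ → V) : V := ∑' j, Ring.multichoose (-n) j • f j

theorem altSum_zero_left (f : ℕ → V) : altSum 0 f = f 0 := by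
  rw [altSum, tsum_eq_single 0]
  · simp
  · rintro (_ | j) hj
    · exact absurd rfl hj
    · rw [neg_zero, Ring.multichoose_zero_succ, zero_smul]

variable [IsUltrametricDist V]

theorem norm_altSum_le (n : ℤ) {f : ℕ → V} {C : ℝ} (h : ∀ j, ‖f j‖ ≤ C) : ‖altSum n f‖ ≤ C :=
  IsUltrametricDist.norm_tsum_le_of_forall_le fun j =>
    (IsUltrametricDist.norm_zsmul_le _ _).trans (h j)

theorem tendsto_zsmul_zero (c : ℕ → ℤ) {f : ℕ → V} (h : Tendsto f atTop (𝓝 0)) :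
    Tendsto (fun j => c j • f j) atTop (𝓝 0) :=
  squeeze_zero_norm (fun _ => IsUltrametricDist.norm_zsmul_le _ _) (by simpa using h.norm)

variable [CompleteSpace V]

theorem summable_zsmul (c : ℕ → ℤ) {f : ℕ → V} (h : Tendsto f atTop (𝓝 0)) :
    Summable fun j => c j • f j := summable_of_tendsto_zero (tendsto_zsmul_zero c h)

theorem altSum_sub (n : ℤ) {f g : ℕ → V} (hf : Tendsto f atTop (𝓝 0))
    (hg : Tendsto g atTop (𝓝 0)) :
    altSum n (fun j => f j - g j) = altSum n f - altSum n g := by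
  simp only [altSum, smul_sub]
  exact (summable_zsmul _ hf).tsum_sub (summable_zsmul _ hg)

theorem altSum_zsmul (n c : ℤ) {f : ℕ → V} (hf : Tendsto f atTop (𝓝 0)) :
    altSum n (fun j => c • f j) = c • altSum n f := by
  simp only [altSum, smul_comm _ c]
  exact (summable_zsmul _ hf).tsum_const_smul c

theorem map_altSum (n : ℤ) (T : V →+ V) (hT : Continuous T) {f : ℕ → V}
    (hf : Tendsto f atTop (𝓝 0)) : T (altSum n f) = altSum n fun j => T (f j) := by
  simp only [altSum, (summable_zsmul _ hf).map_tsum T hT, map_zsmul]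

/-- The identity `(1 - x)^(n+1) = (1 - x) (1 - x)^n`: one factor is moved into the sequence. -/
theorem altSum_add_one (n : ℤ) {f : ℕ → V} (hf : Tendsto f atTop (𝓝 0)) :
    altSum (n + 1) f = altSum n fun j => f j - f (j + 1) := by
  have hf' : Tendsto (fun j => f (j + 1)) atTop (𝓝 0) := (tendsto_add_atTop_iff_nat 1).mpr hf
  rw [altSum_sub n hf hf']
  simp only [altSum]
  rw [(summable_zsmul _ hf).tsum_eq_zero_add,
    (summable_zsmul (Ring.multichoose (-n)) hf).tsum_eq_zero_add]
  simp only [multichoose_neg_add_one, sub_smul]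
  rw [(summable_zsmul (fun j => Ring.multichoose (-n) (j + 1)) hf').tsum_sub
    (summable_zsmul _ hf')]
  simp only [Ring.multichoose_zero_right]
  abel

/-- The differential equation `(1 - x) y' = -n y` of `y = (1 - x)^n`, paired with a null sequence:
the series telescopes. -/
theorem altSum_euler (n : ℤ) {f : ℕ → V} (hf : Tendsto f atTop (𝓝 0)) :
    altSum n (fun j => (j : ℤ) • f j + (n - j) • f (j + 1)) = 0 := by
  have hf' : Tendsto (fun j => f (j + 1)) atTop (𝓝 0) := (tendsto_add_atTop_iff_nat 1).mpr hf
  have hs := summable_zsmul (fun j => Ring.multichoose (-n) j * j) hf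
  have h : ∀ j : ℕ, Ring.multichoose (-n) j • ((j : ℤ) • f j + (n - j) • f (j + 1))
      = (Ring.multichoose (-n) j * j) • f j
        - (Ring.multichoose (-n) (j + 1) * (j + 1 : ℕ)) • f (j + 1) := fun j => by
    have h1 := succ_mul_multichoose (-n) j
    rw [smul_add, smul_smul, smul_smul, sub_eq_add_neg (_ • f j), ← neg_smul]
    congr 2
    push_cast
    linear_combination h1
  simp only [altSum, h]
  rw [hs.tsum_sub (summable_zsmul (fun j => Ring.multichoose (-n) (j + 1) * (j + 1 : ℕ)) hf'),
    hs.tsum_eq_zero_add]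
  simp

end AltSum

/-! ### Multiplication by a difference of two variables -/

section DiffOp

variable {G V : Type*} [AddCommGroup G]

variable (V) in
/-- Multiplication by the difference of two formal variables, acting on families of vectors indexed
by exponents: `x` and `y` are the index shifts caused by the two variables. -/
def diffOp [AddCommGroup V] (x y : G) : Module.End ℤ (G → V) where
  toFun F p := F (p + x) - F (p + y)
  map_add' F H := by
    funext p
    simp only [Pi.add_apply]
    abel
  map_smul' c F := by
    funext p
    simp only [Pi.smul_apply, smul_sub, RingHom.id_apply]

theorem diffOp_apply [AddCommGroup V] (x y : G) (F : G → V) (p : G) :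
    diffOp V x y F p = F (p + x) - F (p + y) := rfl

theorem diffOp_commute [AddCommGroup V] (x y z w : G) :
    Commute (diffOp V x y) (diffOp V z w) := by
  ext F p
  simp only [Module.End.mul_apply, diffOp_apply, add_right_comm p z, add_right_comm p w]
  abel

variable [NormedAddCommGroup V]

theorem norm_diffOp_pow_le [IsUltrametricDist V] (x y : G) {F : G → V} {C : ℝ}
    (h : ∀ p, ‖F p‖ ≤ C) (N : ℕ) (p : G) : ‖(diffOp V x y ^ N) F p‖ ≤ C := by
  induction N generalizing p with
  | zero => exact h p
  | succ N ih =>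
    rw [pow_succ']
    exact norm_sub_le_of_le (ih _) (ih _)

/-- `F` tends to `0` along every ray in the direction `d`: the condition for multiplying `F` by a
series infinite in the opposite direction. -/
def DecaysAlong (d : G) (F : G → V) : Prop :=
  ∀ p, Tendsto (fun j : ℕ => F (p + j • d)) atTop (𝓝 0)

theorem DecaysAlong.diffOp_apply {d : G} {F : G → V} (h : DecaysAlong d F) (x y : G) :
    DecaysAlong d (diffOp V x y F) := fun p => by
  simpa only [NonArchVertex.diffOp_apply, add_right_comm p, sub_zero] using
    (h (p + x)).sub (h (p + y))

theorem DecaysAlong.diffOp_pow_apply {d : G} {F : G → V} (h : DecaysAlong d F) (x y : G) (N : ℕ) :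
    DecaysAlong d ((diffOp V x y ^ N) F) := by
  induction N with
  | zero => exact h
  | succ N ih =>
    rw [pow_succ']
    exact ih.diffOp_apply x y

theorem DecaysAlong.sub {d : G} {F H : G → V} (hF : DecaysAlong d F) (hH : DecaysAlong d H) :
    DecaysAlong d (F - H) := fun p => by
  simpa using (hF p).sub (hH p)

end DiffOp

/-! ### Residues against the two expansions of `(z - w)^n` -/

section Residue

variable {V : Type*} [NormedAddCommGroup V]

/-- Index shift caused by `z` in a series in `z, w, x`; as for fields, the triple `(m, n, l)` stands
for `z^(-m-1) w^(-n-1) x^(-l-1)`. -/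
abbrev eZ : ℤ × ℤ × ℤ := (1, 0, 0)

/-- Index shift caused by `w` in a series in `z, w, x`. -/
abbrev eW : ℤ × ℤ × ℤ := (0, 1, 0)

/-- Index shift caused by `x` in a series in `z, w, x`. -/
abbrev eX : ℤ × ℤ × ℤ := (0, 0, 1)

/-- The residue in `z` of `(z - w)^n F - (z - w)^n F'`, a series in `w` and `x`, where `(z - w)^n` is
expanded in `|z| > |w|` in the first term and in `|w| > |z|` in the second. -/
noncomputable def resDiff (n : ℤ) (F F' : ℤ × ℤ × ℤ → V) (p : ℤ × ℤ) : V :=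
  altSum n (fun j => F ((n, p.1, p.2) + j • (eW - eZ)))
    - Int.negOnePow n • altSum n (fun j => F' ((0, n + p.1, p.2) + j • (eZ - eW)))

variable [IsUltrametricDist V]

theorem norm_resDiff_le (n : ℤ) {F F' : ℤ × ℤ × ℤ → V} {C : ℝ} (hF : ∀ p, ‖F p‖ ≤ C)
    (hF' : ∀ p, ‖F' p‖ ≤ C) (p : ℤ × ℤ) : ‖resDiff n F F' p‖ ≤ C :=
  norm_sub_le_of_le (norm_altSum_le n fun _ => hF _)
    ((IsUltrametricDist.norm_zsmul_le _ _).trans (norm_altSum_le n fun _ => hF' _))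

variable [CompleteSpace V] {F F' : ℤ × ℤ × ℤ → V}

theorem resDiff_sub (n : ℤ) {H H' : ℤ × ℤ × ℤ → V} (hF : DecaysAlong (eW - eZ) F)
    (hF' : DecaysAlong (eZ - eW) F') (hH : DecaysAlong (eW - eZ) H)
    (hH' : DecaysAlong (eZ - eW) H') :
    resDiff n (F - H) (F' - H') = resDiff n F F' - resDiff n H H' := by
  funext p
  simp only [resDiff, Pi.sub_apply]
  rw [altSum_sub n (hF _) (hH _), altSum_sub n (hF' _) (hH' _), smul_sub]
  abel

theorem resDiff_diffOp_eW_eX (n : ℤ) (hF : DecaysAlong (eW - eZ) F)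
    (hF' : DecaysAlong (eZ - eW) F') :
    resDiff n (diffOp V eW eX F) (diffOp V eW eX F') = diffOp V (1, 0) (0, 1) (resDiff n F F') := by
  funext p
  simp only [resDiff, diffOp_apply, add_right_comm _ _ eW, add_right_comm _ _ eX]
  rw [altSum_sub n (hF _) (hF _), altSum_sub n (hF' _) (hF' _), smul_sub]
  simp only [Prod.mk_add_mk, Prod.fst_add, Prod.snd_add, add_zero, add_assoc]
  abel

theorem resDiff_diffOp_eZ_eW (n : ℤ) (hF : DecaysAlong (eW - eZ) F)
    (hF' : DecaysAlong (eZ - eW) F') :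
    resDiff n (diffOp V eZ eW F) (diffOp V eZ eW F') = resDiff (n + 1) F F' := by
  funext p
  simp only [resDiff]
  rw [altSum_add_one n (hF _), altSum_add_one n (hF' _), Int.negOnePow_succ, Units.neg_smul,
    ← smul_neg, ← neg_one_zsmul, ← altSum_zsmul]
  · congr 3
    · funext j
      rw [diffOp_apply]
      congr 2 <;> ext <;> simp <;> ring
    · funext j
      rw [diffOp_apply, neg_one_zsmul, neg_sub]
      congr 2 <;> ext <;> simp <;> ring
  · have h := hF' (0, n + 1 + p.1, p.2)
    simpa using h.sub ((tendsto_add_atTop_iff_nat 1).mpr h)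

/-- For `n ≥ 0` the two expansions agree, and the residue depends only on `F - F'`. -/
theorem resDiff_natCast (n : ℕ) (hF : DecaysAlong (eW - eZ) F) (hF' : DecaysAlong (eZ - eW) F')
    (p : ℤ × ℤ) : resDiff n F F' p = (diffOp V eZ eW ^ n) (F - F') (0, p.1, p.2) := by
  induction n generalizing F F' with
  | zero =>
    obtain ⟨p, q⟩ := p
    simp [resDiff, altSum_zero_left]
  | succ n ih =>
    rw [Nat.cast_succ, ← resDiff_diffOp_eZ_eW n hF hF',
      ih (hF.diffOp_apply _ _) (hF'.diffOp_apply _ _), pow_succ, ← map_sub, Module.End.mul_apply]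

end Residue

/-! ### Products of coefficients of two fields -/

section Words

variable {K V : Type*} [NormedCommRing K] [NormedAddCommGroup V] [Module K V] [IsBoundedSMul K V]

theorem continuous_bddEnd (S : BddEnd K V) : Continuous S.1 :=
  AddMonoidHomClass.continuous_of_bound S.1 ‖S‖ (norm_apply_le S)

theorem QField.tendsto_coeff_apply_zero (a : QField K V) (g : ℕ → ℤ) {x : ℕ → V}
    (hx : Tendsto x atTop (𝓝 0)) : Tendsto (fun j => (a.coeff (g j)).1 (x j)) atTop (𝓝 0) :=
  squeeze_zero_norm (fun j => a.norm_coeff_apply_le (g j) (x j))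
    (by simpa using hx.norm.const_mul ‖a‖)

theorem add_nsmul_eW_sub_eZ (m n l : ℤ) (j : ℕ) :
    (m, n, l) + j • (eW - eZ) = (m - j, n + j, l) := by
  ext <;> simp [sub_eq_add_neg]

theorem add_nsmul_eZ_sub_eW (m n l : ℤ) (j : ℕ) :
    (m, n, l) + j • (eZ - eW) = (m + j, n - j, l) := by
  ext <;> simp [sub_eq_add_neg]

/-- The coefficients of `a(z) b(w) u(x)`, for a family `u` of vectors. -/
def wordZW (a b : QField K V) (u : ℤ → V) : ℤ × ℤ × ℤ → V :=
  fun q => (a.coeff q.1).1 ((b.coeff q.2.1).1 (u q.2.2))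

/-- The coefficients of `b(w) a(z) u(x)`, still indexed by the powers of `z`, `w`, `x` in this order. -/
def wordWZ (a b : QField K V) (u : ℤ → V) : ℤ × ℤ × ℤ → V :=
  fun q => (b.coeff q.2.1).1 ((a.coeff q.1).1 (u q.2.2))

theorem wordZW_decays (a b : QField K V) (u : ℤ → V) : DecaysAlong (eW - eZ) (wordZW a b u) := by
  rintro ⟨m, n, l⟩
  simp only [add_nsmul_eW_sub_eZ]
  exact a.tendsto_coeff_apply_zero _ ((b.tendsto_coeff_apply (u l)).comp (tendsto_intCast_add n))

theorem wordWZ_decays (a b : QField K V) (u : ℤ → V) : DecaysAlong (eZ - eW) (wordWZ a b u) := by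
  rintro ⟨m, n, l⟩
  simp only [add_nsmul_eZ_sub_eW]
  exact b.tendsto_coeff_apply_zero _ ((a.tendsto_coeff_apply (u l)).comp (tendsto_intCast_add m))

theorem DecaysAlong.coeff_comp {d : ℤ × ℤ × ℤ} {F : ℤ × ℤ × ℤ → V} (h : DecaysAlong d F)
    (c : QField K V) : DecaysAlong d fun q => (c.coeff q.2.2).1 (F q) :=
  fun p => c.tendsto_coeff_apply_zero _ (h p)

/-- Multiplying by `(z - w)^N` commutes with applying additive maps `E q` that do not depend on the
two indices concerned. This transfers locality, a statement on operators in two variables, to vectors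
in three variables. -/
theorem diffOp_pow_mulZSubW {G : Type*} [AddCommGroup G] {x y : G} {π : G → ℤ × ℤ}
    (hπx : ∀ q, π (q + x) = π q + (1, 0)) (hπy : ∀ q, π (q + y) = π q + (0, 1))
    {E : G → BddEnd K V → V} (hEx : ∀ q, E (q + x) = E q) (hEy : ∀ q, E (q + y) = E q)
    (hE : ∀ q S S', E q (S - S') = E q S - E q S') (Φ : ℤ × ℤ → BddEnd K V) (N : ℕ) :
    (diffOp V x y ^ N) (fun q => E q (Φ (π q))) = fun q => E q ((mulZSubW^[N] Φ) (π q)) := by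
  induction N with
  | zero => rfl
  | succ N ih =>
    rw [pow_succ', Module.End.mul_apply, ih, Function.iterate_succ_apply']
    funext q
    have h1 : π q + (1, 0) = ((π q).1 + 1, (π q).2) := by ext <;> simp
    have h2 : π q + (0, 1) = ((π q).1, (π q).2 + 1) := by ext <;> simp
    simp only [diffOp_apply, hπx, hπy, hEx, hEy, ← hE, mulZSubW, h1, h2]

end Words

/-! ### The `n`-th product as a residue, uniformly in `n` -/

section Formula

variable {K V : Type*} [NormedCommRing K] [NormedAddCommGroup V] [Module K V] [IsBoundedSMul K V]
  [IsUltrametricDist V] [CompleteSpace V]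

/-- One formula for all integers `n`:
`a(w)_(n) b(w) = Res_z (a(z) b(w) (z-w)^n - b(w) a(z) (z-w)^n)`, with the factor expanded in
`|z| > |w|`, respectively `|w| > |z|`. The vectors `u l` only carry a third index along. -/
theorem nthProd_coeff_apply (a b : QField K V) (n p : ℤ) (u : ℤ → V) (l : ℤ) :
    ((nthProd a b n).coeff p).1 (u l) = resDiff n (wordZW a b u) (wordWZ a b u) (p, l) := by
  rcases n with n | m
  · rw [Int.ofNat_eq_natCast, resDiff_natCast n (wordZW_decays a b u) (wordWZ_decays a b u)]
    have h := congrFun (diffOp_pow_mulZSubW (x := eZ) (y := eW) (π := fun q => (q.1, q.2.1))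
      (E := fun q S => S.1 (u q.2.2)) (by simp) (by simp) (by simp) (by simp) (by simp)
      (comm a b) n) (0, p, l)
    exact h.symm
  -- The coefficients `((m-j-1) choose m)` of the divided derivative vanish for `0 ≤ j < m`, so the
  -- second sum of the normally ordered product starts at `j = m`.
  · have hs : Summable fun j : ℕ =>
        (b.coeff (p - 1 - j)).1 (((divDeriv m a).coeff j).1 (u l)) :=
      normal_summable_right (divDeriv m a) b p (u l)
    have hn : Int.negSucc m = -((m : ℤ) + 1) := Int.negSucc_eq m
    have h0 : ((nthProd a b (Int.negSucc m)).coeff p).1 (u l)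
        = ∑' j : ℕ, ((divDeriv m a).coeff (-1 - j)).1 ((b.coeff (p + j)).1 (u l))
          + ∑' j : ℕ, (b.coeff (p - 1 - j)).1 (((divDeriv m a).coeff j).1 (u l)) := rfl
    have hd : ∀ (k : ℤ) (v : V), ((divDeriv m a).coeff k).1 v
        = Ring.choose ((m : ℤ) - k - 1) m • (a.coeff (k - m)).1 v := fun _ _ => rfl
    rw [h0, ← hs.sum_add_tsum_nat_add m, Finset.sum_eq_zero, zero_add, resDiff,
      sub_eq_add_neg (altSum _ _),
      ← Units.neg_smul]
    · simp only [add_nsmul_eW_sub_eZ, add_nsmul_eZ_sub_eW, altSum, hn, neg_neg,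
        multichoose_natCast_add_one]
      congr 1
      · refine tsum_congr fun j => ?_
        rw [hd, show (m : ℤ) - (-1 - j) - 1 = ((m + j : ℕ) : ℤ) by push_cast; ring,
          Ring.choose_natCast, show -1 - (j : ℤ) - m = -(m + 1) - j by ring]
        rfl
      · have hm : -(-((m : ℤ) + 1)).negOnePow = (m : ℤ).negOnePow := by
          rw [Int.negOnePow_neg, Int.negOnePow_succ, neg_neg]
        rw [hm, ← Summable.tsum_const_smul]
        · refine tsum_congr fun j => ?_
          rw [hd, show (m : ℤ) - (j + m : ℕ) - 1 = -((j : ℤ) + 1) by push_cast; ring,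
            Ring.choose_neg', multichoose_natCast_add_one, map_zsmul, Nat.choose_symm_add,
            add_comm j m]
          rw [smul_assoc, show p - 1 - ((m + j : ℕ) : ℤ) = -((m : ℤ) + 1) + p - j by push_cast; ring,
            show ((m + j : ℕ) : ℤ) - m = 0 + j by push_cast; ring]
          rfl
        · exact summable_zsmul _ (by
            simpa only [add_nsmul_eZ_sub_eW] using wordWZ_decays a b u (0, -((m : ℤ) + 1) + p, l))
    · intro j hj
      have hj := Finset.mem_range.mp hj
      rw [hd, show (m : ℤ) - j - 1 = ((m - j - 1 : ℕ) : ℤ) by omega, Ring.choose_natCast,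
        Nat.choose_eq_zero_of_lt (by omega)]
      simp

end Formula

/-! ### Dong's lemma -/

section Locality

variable {K V : Type*} [NormedCommRing K] [NormedAddCommGroup V] [Module K V] [IsBoundedSMul K V]

theorem iterate_mulZSubW_comm_swap (a b : QField K V) (N : ℕ) (p : ℤ × ℤ) :
    ‖(mulZSubW^[N] (comm b a)) p‖ = ‖(mulZSubW^[N] (comm a b)) p.swap‖ := by
  have h : ∀ N p, (mulZSubW^[N] (comm b a)) p
      = (-1 : ℤ) ^ (N + 1) • (mulZSubW^[N] (comm a b)) p.swap := by
    intro N
    induction N with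
    | zero =>
      intro p
      rw [zero_add, pow_one, neg_one_zsmul]
      exact (neg_sub _ _).symm
    | succ N ih =>
      intro p
      rw [Function.iterate_succ_apply', Function.iterate_succ_apply', mulZSubW, ih, ih, mulZSubW,
        ← smul_sub, pow_succ _ (N + 1), mul_neg_one, neg_smul, ← smul_neg, neg_sub]
      rfl
  rw [h]
  rcases neg_one_pow_eq_or ℤ (N + 1) with h | h <;> simp [h]

theorem mutuallyLocal_iff {a b : QField K V} : MutuallyLocal a b ↔
    ∀ ε > 0, ∃ N₀ : ℕ, ∀ N ≥ N₀, ∀ p, ‖(mulZSubW^[N] (comm a b)) p‖ < ε := by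
  simp only [MutuallyLocal, Metric.tendstoUniformly_iff, Pi.zero_apply, dist_zero_left,
    eventually_atTop]

theorem MutuallyLocal.symm {a b : QField K V} (h : MutuallyLocal a b) : MutuallyLocal b a := by
  rw [mutuallyLocal_iff] at h ⊢
  intro ε hε
  obtain ⟨N₀, hN⟩ := h ε hε
  exact ⟨N₀, fun N hN₀ p => by
    rw [iterate_mulZSubW_comm_swap]
    exact hN N hN₀ _⟩

theorem norm_diffOp_pow_mulZSubW_le {x y : ℤ × ℤ × ℤ} {π : ℤ × ℤ × ℤ → ℤ × ℤ}
    (hπx : ∀ q, π (q + x) = π q + (1, 0)) (hπy : ∀ q, π (q + y) = π q + (0, 1))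
    {E : ℤ × ℤ × ℤ → BddEnd K V → V} (hEx : ∀ q, E (q + x) = E q) (hEy : ∀ q, E (q + y) = E q)
    (hE : ∀ q S S', E q (S - S') = E q S - E q S') {C δ : ℝ} (hC : 0 ≤ C)
    (hEC : ∀ q S, ‖E q S‖ ≤ C * ‖S‖) {Φ : ℤ × ℤ → BddEnd K V} {N : ℕ}
    (hΦ : ∀ p, ‖(mulZSubW^[N] Φ) p‖ ≤ δ) (q : ℤ × ℤ × ℤ) :
    ‖(diffOp V x y ^ N) (fun q => E q (Φ (π q))) q‖ ≤ C * δ := by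
  rw [diffOp_pow_mulZSubW hπx hπy hEx hEy hE]
  exact (hEC _ _).trans (mul_le_mul_of_nonneg_left (hΦ _) hC)

variable [IsUltrametricDist V] [CompleteSpace V]

/-- The estimate behind Dong's lemma. Let `D` bound `(z-x)^s (w-x)^r X` and `(z-x)^s (w-x)^r Y` for
`s ≥ r`, and `(z-w)^k (X - Y)` for `k ≥ r`. Writing `w - x = (z-x) - (z-w)`, the product of
`(w-x)^(M+r)` with the residue of order `n` is a signed sum of residues of order `n + i` of
`(z-x)^s (w-x)^r X` and `(z-x)^s (w-x)^r Y` with `i + s = M`. If `M + n ≥ 2r`, then `s ≥ r` or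
`n + i ≥ r`, and in both cases the residue is bounded by `D`. -/
theorem norm_diffOp_pow_resDiff_le {X Y : ℤ × ℤ × ℤ → V} (hX : DecaysAlong (eW - eZ) X)
    (hY : DecaysAlong (eZ - eW) Y) {D : ℝ} {r : ℕ}
    (hXD : ∀ s ≥ r, ∀ q, ‖((diffOp V eZ eX ^ s) * (diffOp V eW eX ^ r)) X q‖ ≤ D)
    (hYD : ∀ s ≥ r, ∀ q, ‖((diffOp V eZ eX ^ s) * (diffOp V eW eX ^ r)) Y q‖ ≤ D)
    (hXY : ∀ k ≥ r, ∀ q, ‖(diffOp V eZ eW ^ k) (X - Y) q‖ ≤ D)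
    (n : ℤ) {M : ℕ} (hM : (2 * r : ℤ) ≤ M + n) (p : ℤ × ℤ) :
    ‖(diffOp V (1, 0) (0, 1) ^ (M + r)) (resDiff n X Y) p‖ ≤ D := by
  set zx := diffOp V eZ eX with hzx
  set wx := diffOp V eW eX with hwx
  set zw := diffOp V eZ eW with hzw
  have hdiff : ∀ F, wx F = zx F - zw F := fun F => by
    funext q
    simp only [hzx, hwx, hzw, Pi.sub_apply, diffOp_apply]
    abel
  have hXd : ∀ s t, DecaysAlong (eW - eZ) ((zx ^ s * wx ^ t) X) := fun s t =>
    (hX.diffOp_pow_apply _ _ t).diffOp_pow_apply _ _ s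
  have hYd : ∀ s t, DecaysAlong (eZ - eW) ((zx ^ s * wx ^ t) Y) := fun s t =>
    (hY.diffOp_pow_apply _ _ t).diffOp_pow_apply _ _ s
  have hbase : ∀ (n : ℤ) (s : ℕ), (2 * r : ℤ) ≤ n + s → ∀ p,
      ‖resDiff n ((zx ^ s * wx ^ r) X) ((zx ^ s * wx ^ r) Y) p‖ ≤ D := by
    intro n s hns p
    rcases le_or_gt r s with hs | hs
    · exact norm_resDiff_le n (hXD s hs) (hYD s hs) p
    · obtain ⟨k, rfl⟩ := Int.eq_ofNat_of_zero_le (show 0 ≤ n by omega)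
      rw [resDiff_natCast k (hXd s r) (hYd s r), ← map_sub,
        ← Module.End.mul_apply]
      have hc : Commute (zw ^ k) (zx ^ s * wx ^ r) :=
        ((diffOp_commute _ _ _ _).pow_pow k s).mul_right ((diffOp_commute _ _ _ _).pow_pow k r)
      rw [hc.eq, Module.End.mul_apply, Module.End.mul_apply]
      exact norm_diffOp_pow_le _ _
        (norm_diffOp_pow_le _ _ (hXY k (by omega)) r) s _
  have key : ∀ (M : ℕ) (n : ℤ) (s : ℕ), (2 * r : ℤ) ≤ M + n + s → ∀ p,
      ‖(diffOp V (1, 0) (0, 1) ^ M) (resDiff n ((zx ^ s * wx ^ r) X) ((zx ^ s * wx ^ r) Y)) p‖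
        ≤ D := by
    intro M
    induction M with
    | zero => exact fun n s h p => hbase n s (by simpa using h) p
    | succ M ih =>
      intro n s h p
      rw [pow_succ, Module.End.mul_apply, ← resDiff_diffOp_eW_eX n (hXd s r) (hYd s r), ← hwx,
        hdiff, hdiff, resDiff_sub n ((hXd s r).diffOp_apply _ _) ((hYd s r).diffOp_apply _ _)
          ((hXd s r).diffOp_apply _ _) ((hYd s r).diffOp_apply _ _),
        resDiff_diffOp_eZ_eW n (hXd s r) (hYd s r), map_sub, ← Module.End.mul_apply zx,
        ← Module.End.mul_apply zx, ← mul_assoc, ← pow_succ']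
      push_cast at h
      exact norm_sub_le_of_le (ih n (s + 1) (by push_cast; linarith) p)
        (ih (n + 1) s (by linarith) p)
  have hwr : ∀ t, resDiff n ((wx ^ t) X) ((wx ^ t) Y)
      = (diffOp V (1, 0) (0, 1) ^ t) (resDiff n X Y) := by
    intro t
    induction t with
    | zero => rfl
    | succ t ih =>
      rw [pow_succ', pow_succ', Module.End.mul_apply, Module.End.mul_apply, Module.End.mul_apply,
        ← ih, ← resDiff_diffOp_eW_eX n (hX.diffOp_pow_apply _ _ t) (hY.diffOp_pow_apply _ _ t)]
  have h := key M n 0 (by simpa using hM) p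
  rwa [pow_zero, one_mul, hwr, ← Module.End.mul_apply, ← pow_add] at h

/-- The commutator of `a_(n) b` with `c`, as a residue of `[a(z)b(w), c(x)]` and `[b(w)a(z), c(x)]`. -/
theorem nthProd_comm_apply (a b c : QField K V) (n : ℤ) (v : V) :
    (fun q => (comm (nthProd a b n) c q).1 v)
      = resDiff n
        (wordZW a b (fun l => (c.coeff l).1 v)
          - fun q => (c.coeff q.2.2).1 (wordZW a b (fun _ => v) q))
        (wordWZ a b (fun l => (c.coeff l).1 v)
          - fun q => (c.coeff q.2.2).1 (wordWZ a b (fun _ => v) q)) := by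
  funext ⟨p, l⟩
  have hZ := wordZW_decays a b fun _ => v
  have hW := wordWZ_decays a b fun _ => v
  rw [resDiff_sub n (wordZW_decays _ _ _) (wordWZ_decays _ _ _) (hZ.coeff_comp c)
    (hW.coeff_comp c), Pi.sub_apply, ← nthProd_coeff_apply, comm_apply,
    nthProd_coeff_apply a b n p (fun _ => v) l]
  congr 1
  have hc := continuous_bddEnd (c.coeff l)
  have hmap : ∀ {f : ℕ → V}, Tendsto f atTop (𝓝 0) →
      (c.coeff l).1 (altSum n f) = altSum n fun j => (c.coeff l).1 (f j) :=
    fun hf => map_altSum n (c.coeff l).1.toAddMonoidHom hc hf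
  simp only [resDiff]
  rw [map_sub, Units.smul_def, map_zsmul, hmap (hZ _), hmap (hW _)]
  simp only [add_nsmul_eW_sub_eZ, add_nsmul_eZ_sub_eW]
  rfl

theorem norm_iterate_comm_nthProd_le {a b c : QField K V} {B δ : ℝ} (hBpos : 0 ≤ B)
    (haB : ‖a‖ ≤ B) (hbB : ‖b‖ ≤ B) (hcB : ‖c‖ ≤ B) {r : ℕ}
    (hab : ∀ N ≥ r, ∀ p, ‖(mulZSubW^[N] (comm a b)) p‖ ≤ δ)
    (hac : ∀ N ≥ r, ∀ p, ‖(mulZSubW^[N] (comm a c)) p‖ ≤ δ)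
    (hbc : ∀ N ≥ r, ∀ p, ‖(mulZSubW^[N] (comm b c)) p‖ ≤ δ)
    (n : ℤ) {N : ℕ} (hN : 3 * r + n.natAbs ≤ N) (p : ℤ × ℤ) (v : V) :
    ‖((mulZSubW^[N] (comm (nthProd a b n) c)) p).1 v‖ ≤ B * ‖v‖ * δ := by
  have hCv : 0 ≤ B * ‖v‖ := by positivity
  have hcoeff : ∀ {d : QField K V}, ‖d‖ ≤ B → ∀ (k : ℤ) (x : V),
      ‖(d.coeff k).1 x‖ ≤ B * ‖x‖ := fun hd k x =>
    (QField.norm_coeff_apply_le _ k x).trans (mul_le_mul_of_nonneg_right hd (norm_nonneg x))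
  have hleft : ∀ {d : QField K V}, ‖d‖ ≤ B → ∀ (k : ℤ) (S : BddEnd K V),
      ‖(d.coeff k).1 (S.1 v)‖ ≤ B * ‖v‖ * ‖S‖ := fun hd k S =>
    (hcoeff hd k _).trans ((mul_le_mul_of_nonneg_left (norm_apply_le S v) hBpos).trans_eq
      (by ring))
  have hright : ∀ {d : QField K V}, ‖d‖ ≤ B → ∀ (k : ℤ) (S : BddEnd K V),
      ‖S.1 ((d.coeff k).1 v)‖ ≤ B * ‖v‖ * ‖S‖ := fun hd k S =>
    (norm_apply_le S _).trans ((mul_le_mul_of_nonneg_left (hcoeff hd k v)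
      (norm_nonneg S)).trans_eq (by ring))
  have hsum : ∀ {X X₁ X₂ : ℤ × ℤ × ℤ → V}, X = X₁ + X₂ →
      (∀ q, ‖(diffOp V eW eX ^ r) X₁ q‖ ≤ B * ‖v‖ * δ) →
      (∀ s ≥ r, ∀ q, ‖(diffOp V eZ eX ^ s) X₂ q‖ ≤ B * ‖v‖ * δ) →
      ∀ s ≥ r, ∀ q, ‖((diffOp V eZ eX ^ s) * (diffOp V eW eX ^ r)) X q‖ ≤ B * ‖v‖ * δ := by
    rintro _ X₁ X₂ rfl h₁ h₂ s hs q
    rw [map_add]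
    refine norm_add_le_of_le (norm_diffOp_pow_le _ _ h₁ s q) ?_
    rw [((diffOp_commute eZ eX eW eX).pow_pow s r).eq]
    exact norm_diffOp_pow_le _ _ (h₂ s hs) r q
  have hiter : (mulZSubW^[N] (comm (nthProd a b n) c) p).1 v
      = (diffOp V (1, 0) (0, 1) ^ N) (fun q => (comm (nthProd a b n) c q).1 v) p :=
    (congrFun (diffOp_pow_mulZSubW (G := ℤ × ℤ) (π := id) (E := fun _ S => S.1 v)
      (by simp) (by simp) (by simp) (by simp) (by simp) _ N) p).symm
  obtain ⟨M, rfl⟩ : ∃ M, N = M + r := ⟨N - r, by omega⟩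
  rw [hiter, nthProd_comm_apply]
  refine norm_diffOp_pow_resDiff_le (r := r)
    ((wordZW_decays _ _ _).sub ((wordZW_decays _ _ _).coeff_comp c))
    ((wordWZ_decays _ _ _).sub ((wordWZ_decays _ _ _).coeff_comp c)) ?_ ?_ ?_ n (by omega) p
  -- `[a(z) b(w), c(x)] = a(z) [b(w), c(x)] + [a(z), c(x)] b(w)`
  · refine hsum (X₁ := fun q => (a.coeff q.1).1 ((comm b c q.2).1 v))
      (X₂ := fun q => (comm a c (q.1, q.2.2)).1 ((b.coeff q.2.1).1 v)) ?_ ?_ ?_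
    · funext q
      simp only [wordZW, Pi.sub_apply, Pi.add_apply, comm_apply, map_sub]
      abel
    · exact norm_diffOp_pow_mulZSubW_le (π := fun q => q.2)
        (E := fun q S => (a.coeff q.1).1 (S.1 v)) (by simp) (by simp) (by simp) (by simp)
        (by simp) hCv (fun q => hleft haB q.1) (hbc r le_rfl)
    · exact fun s hs => norm_diffOp_pow_mulZSubW_le (π := fun q => (q.1, q.2.2))
        (E := fun q S => S.1 ((b.coeff q.2.1).1 v)) (by simp) (by simp) (by simp) (by simp)
        (by simp) hCv (fun q => hright hbB q.2.1) (hac s hs)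
  -- `[b(w) a(z), c(x)] = [b(w), c(x)] a(z) + b(w) [a(z), c(x)]`
  · refine hsum (X₁ := fun q => (comm b c q.2).1 ((a.coeff q.1).1 v))
      (X₂ := fun q => (b.coeff q.2.1).1 ((comm a c (q.1, q.2.2)).1 v)) ?_ ?_ ?_
    · funext q
      simp only [wordWZ, Pi.sub_apply, Pi.add_apply, comm_apply, map_sub]
      abel
    · exact norm_diffOp_pow_mulZSubW_le (π := fun q => q.2)
        (E := fun q S => S.1 ((a.coeff q.1).1 v)) (by simp) (by simp) (by simp) (by simp)
        (by simp) hCv (fun q => hright haB q.1) (hbc r le_rfl)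
    · exact fun s hs => norm_diffOp_pow_mulZSubW_le (π := fun q => (q.1, q.2.2))
        (E := fun q S => (b.coeff q.2.1).1 (S.1 v)) (by simp) (by simp) (by simp) (by simp)
        (by simp) hCv (fun q => hleft hbB q.2.1) (hac s hs)
  · intro k hk
    have hE := norm_diffOp_pow_mulZSubW_le (x := eZ) (y := eW) (N := k) (δ := δ)
      (π := fun q => (q.1, q.2.1))
      (E := fun q S => S.1 ((c.coeff q.2.2).1 v) - (c.coeff q.2.2).1 (S.1 v))
      (by simp) (by simp) (by simp) (by simp) (fun q S S' => by simp; abel) hCv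
      (fun q S => norm_sub_le_of_le (hright hcB q.2.2 S) (hleft hcB q.2.2 S))
      (hab k hk)
    convert hE using 5
    simp only [wordZW, wordWZ, Pi.sub_apply, comm_apply, map_sub]
    abel

/-- Dong's lemma: if `a`, `b`, `c` are pairwise mutually local, then so are `a_(n) b` and `c`. -/
theorem MutuallyLocal.nthProd_left {a b c : QField K V} (hab : MutuallyLocal a b)
    (hac : MutuallyLocal a c) (hbc : MutuallyLocal b c) (n : ℤ) :
    MutuallyLocal (nthProd a b n) c := by
  rw [mutuallyLocal_iff] at hab hac hbc ⊢
  intro ε hε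
  set B := ‖a‖ + ‖b‖ + ‖c‖ + 1 with hB
  have hBpos : 0 < B := by positivity
  have haB : ‖a‖ ≤ B := by linarith [norm_nonneg b, norm_nonneg c]
  have hbB : ‖b‖ ≤ B := by linarith [norm_nonneg a, norm_nonneg c]
  have hcB : ‖c‖ ≤ B := by linarith [norm_nonneg a, norm_nonneg b]
  -- The factor `ε / 2` turns the non-strict bounds below into a strict one.
  set δ := ε / 2 / B with hδ
  have hδpos : 0 < δ := by positivity
  obtain ⟨r₁, h₁⟩ := hab δ hδpos
  obtain ⟨r₂, h₂⟩ := hac δ hδpos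
  obtain ⟨r₃, h₃⟩ := hbc δ hδpos
  set r := r₁ + r₂ + r₃ with hr
  refine ⟨3 * r + n.natAbs, fun N hN p => lt_of_le_of_lt
    (norm_le_of_forall (C := ε / 2) (by positivity) fun v => ?_) (half_lt_self hε)⟩
  refine (norm_iterate_comm_nthProd_le hBpos.le haB hbB hcB
    (fun N h p => (h₁ N (by omega) p).le) (fun N h p => (h₂ N (by omega) p).le)
    (fun N h p => (h₃ N (by omega) p).le) n hN p v).trans_eq ?_
  rw [hδ]
  field_simp

end Locality

/-! ### Continuity of the `n`-th products -/

section Continuity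

variable {K V : Type*} [NormedCommRing K] [NormedAddCommGroup V] [Module K V] [IsBoundedSMul K V]

theorem QField.ext_apply {a b : QField K V} (h : ∀ n v, (a.coeff n).1 v = (b.coeff n).1 v) :
    a = b :=
  Subtype.ext <| Subtype.ext <| funext fun n => Subtype.ext <| LinearMap.ext fun v => h n v

theorem QField.continuous_coeff_apply (n : ℤ) (v : V) :
    Continuous fun a : QField K V => (a.coeff n).1 v :=
  AddMonoidHomClass.continuous_of_bound
    (AddMonoidHom.mk' (fun a : QField K V => (a.coeff n).1 v) fun _ _ => rfl) ‖v‖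
    fun a => (a.norm_coeff_apply_le n v).trans_eq (mul_comm _ _)

variable [IsUltrametricDist V] [CompleteSpace V]

theorem norm_nthProd_le (a b : QField K V) (n : ℤ) : ‖nthProd a b n‖ ≤ ‖a‖ * ‖b‖ := by
  have h : 0 ≤ ‖a‖ * ‖b‖ := mul_nonneg (norm_nonneg a) (norm_nonneg b)
  refine lp.norm_le_of_forall_le h fun p => norm_le_of_forall h fun v => ?_
  refine (congrArg norm (nthProd_coeff_apply a b n p (fun _ => v) 0)).trans_le
    (norm_resDiff_le n (fun q => norm_coeff_coeff_apply_le a b _ _ v) (fun q => ?_) _)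
  rw [mul_comm ‖a‖]
  exact norm_coeff_coeff_apply_le b a _ _ v

theorem nthProd_sub_left (a a' b : QField K V) (n : ℤ) :
    nthProd (a - a') b n = nthProd a b n - nthProd a' b n := by
  refine QField.ext_apply fun p v => ?_
  have h : ((nthProd a b n - nthProd a' b n).coeff p).1 v
    = ((nthProd a b n).coeff p).1 v - ((nthProd a' b n).coeff p).1 v := rfl
  rw [h, nthProd_coeff_apply _ _ n p (fun _ => v) 0, nthProd_coeff_apply _ _ n p (fun _ => v) 0,
    nthProd_coeff_apply _ _ n p (fun _ => v) 0, ← Pi.sub_apply, ← resDiff_sub n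
      (wordZW_decays _ _ _) (wordWZ_decays _ _ _) (wordZW_decays _ _ _) (wordWZ_decays _ _ _)]
  congr 1
  funext q
  exact (map_sub (b.coeff q.2.1).1 _ _)

theorem nthProd_sub_right (a b b' : QField K V) (n : ℤ) :
    nthProd a (b - b') n = nthProd a b n - nthProd a b' n := by
  refine QField.ext_apply fun p v => ?_
  have h : ((nthProd a b n - nthProd a b' n).coeff p).1 v
    = ((nthProd a b n).coeff p).1 v - ((nthProd a b' n).coeff p).1 v := rfl
  rw [h, nthProd_coeff_apply _ _ n p (fun _ => v) 0, nthProd_coeff_apply _ _ n p (fun _ => v) 0,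
    nthProd_coeff_apply _ _ n p (fun _ => v) 0, ← Pi.sub_apply, ← resDiff_sub n
      (wordZW_decays _ _ _) (wordWZ_decays _ _ _) (wordZW_decays _ _ _) (wordWZ_decays _ _ _)]
  congr 1
  funext q
  exact (map_sub (a.coeff q.1).1 _ _)

theorem continuous_nthProd (n : ℤ) :
    Continuous fun p : QField K V × QField K V => nthProd p.1 p.2 n := by
  rw [continuous_iff_continuousAt]
  rintro ⟨a, b⟩
  refine tendsto_iff_norm_sub_tendsto_zero.mpr
    (squeeze_zero (g := fun p => ‖p.1 - a‖ * ‖p.2‖ + ‖a‖ * ‖p.2 - b‖)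
      (fun _ => norm_nonneg _) (fun p => ?_) ?_)
  · have h : nthProd p.1 p.2 n - nthProd a b n
        = nthProd (p.1 - a) p.2 n + nthProd a (p.2 - b) n := by
      rw [nthProd_sub_left, nthProd_sub_right]
      abel
    rw [h]
    exact (norm_add_le _ _).trans (add_le_add (norm_nthProd_le _ _ n) (norm_nthProd_le _ _ n))
  · have h : Continuous fun p : QField K V × QField K V =>
        ‖p.1 - a‖ * ‖p.2‖ + ‖a‖ * ‖p.2 - b‖ := by fun_prop
    simpa using h.tendsto (a, b)

end Continuity

/-! ### Translation covariance of the `n`-th products -/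

section Covariance

variable {K V : Type*} [NormedCommRing K] [NormedAddCommGroup V] [Module K V] [IsBoundedSMul K V]
  [IsUltrametricDist V]

theorem translationCovariant_iff {T : BddEnd K V} {a : QField K V} :
    TranslationCovariant T a ↔ ∀ (n : ℤ) (v : V),
      T.1 ((a.coeff n).1 v) - (a.coeff n).1 (T.1 v) = -n • (a.coeff (n - 1)).1 v := by
  have h : ∀ (n : ℤ) (v : V), ((divDeriv 1 a).coeff n).1 v = -n • (a.coeff (n - 1)).1 v :=
    fun n v => by
      have h' : ((divDeriv 1 a).coeff n).1 v
        = Ring.choose (((1 : ℕ) : ℤ) - n - 1) 1 • (a.coeff (n - (1 : ℕ))).1 v := rfl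
      rw [h', Ring.choose_one_right]
      congr 1
      push_cast
      ring
  constructor
  · intro ha n v
    rw [← h n v, ← ha n]
    rfl
  · intro ha n
    refine Subtype.ext (LinearMap.ext fun v => ?_)
    rw [h n v, ← ha n v]
    rfl

variable [CompleteSpace V]

/-- If `T` acts on the terms `f j` as a derivation of degree `-1`, then it does so on the sum: the
terms that would spoil this form a series that vanishes by `altSum_euler`. -/
theorem map_altSum_of_commutator (T : BddEnd K V) (n p : ℤ) {f g k h : ℕ → V}
    (hf : Tendsto f atTop (𝓝 0)) (hg : Tendsto g atTop (𝓝 0)) (hk : Tendsto k atTop (𝓝 0))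
    (hh : Tendsto h atTop (𝓝 0))
    (H : ∀ j : ℕ, T.1 (f j) = g j - p • k j - ((j : ℤ) • h j + (n - j) • h (j + 1))) :
    T.1 (altSum n f) = altSum n g - p • altSum n k := by
  have h1 : T.1 (altSum n f) = altSum n fun j => T.1 (f j) :=
    map_altSum n T.1.toAddMonoidHom (continuous_bddEnd T) hf
  have hh' : Tendsto (fun j => h (j + 1)) atTop (𝓝 0) := (tendsto_add_atTop_iff_nat 1).mpr hh
  have h2 := tendsto_zsmul_zero (fun _ => p) hk
  have h3 : Tendsto (fun j : ℕ => (j : ℤ) • h j + (n - j) • h (j + 1)) atTop (𝓝 0) := by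
    simpa using (tendsto_zsmul_zero (fun j => (j : ℤ)) hh).add
      (tendsto_zsmul_zero (fun j => n - j) hh')
  simp only [h1, H]
  rw [altSum_sub n (by simpa using hg.sub h2) h3, altSum_sub n hg h2, altSum_zsmul n p hk,
    altSum_euler n hh, sub_zero]

theorem TranslationCovariant.nthProd {T : BddEnd K V} {a b : QField K V}
    (ha : TranslationCovariant T a) (hb : TranslationCovariant T b) (n : ℤ) :
    TranslationCovariant T (nthProd a b n) := by
  rw [translationCovariant_iff] at ha hb ⊢
  intro p v
  have hword : ∀ {c d : QField K V},
      (∀ (n : ℤ) (v : V), T.1 ((c.coeff n).1 v) - (c.coeff n).1 (T.1 v)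
        = -n • (c.coeff (n - 1)).1 v) →
      (∀ (n : ℤ) (v : V), T.1 ((d.coeff n).1 v) - (d.coeff n).1 (T.1 v)
        = -n • (d.coeff (n - 1)).1 v) → ∀ i j : ℤ,
      T.1 ((c.coeff i).1 ((d.coeff j).1 v)) = (c.coeff i).1 ((d.coeff j).1 (T.1 v))
        - j • (c.coeff i).1 ((d.coeff (j - 1)).1 v)
        - i • (c.coeff (i - 1)).1 ((d.coeff j).1 v) := by
    intro c d hc hd i j
    rw [sub_eq_iff_eq_add.mp (hc i _), sub_eq_iff_eq_add.mp (hd j v), map_add, map_zsmul,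
      neg_smul, neg_smul]
    abel
  have hZ := wordZW_decays a b fun _ => v
  have hW := wordWZ_decays a b fun _ => v
  have hl := map_altSum_of_commutator T n p (hZ (n, p, 0))
    (wordZW_decays a b (fun _ => T.1 v) (n, p, 0)) (hZ (n, p - 1, 0)) (hZ (n, p - 1, 0)) (by
      intro j
      simp only [add_nsmul_eW_sub_eZ, wordZW]
      rw [hword ha hb, show p - 1 + (j : ℤ) = p + j - 1 by ring,
        show p - 1 + ((j + 1 : ℕ) : ℤ) = p + j by push_cast; ring,
        show n - ((j + 1 : ℕ) : ℤ) = n - j - 1 by push_cast; ring]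
      module)
  have hr := map_altSum_of_commutator T n p (hW (0, n + p, 0))
    (wordWZ_decays a b (fun _ => T.1 v) (0, n + p, 0)) (hW (0, n + (p - 1), 0))
    (hW (-1, n + p, 0)) (by
      intro j
      simp only [add_nsmul_eZ_sub_eW, wordWZ]
      rw [hword hb ha, show n + (p - 1) - (j : ℤ) = n + p - j - 1 by ring,
        show n + p - ((j + 1 : ℕ) : ℤ) = n + p - j - 1 by push_cast; ring,
        show -1 + ((j + 1 : ℕ) : ℤ) = 0 + j by push_cast; ring,
        show -1 + (j : ℤ) = 0 + j - 1 by ring]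
      module)
  rw [nthProd_coeff_apply _ _ n p (fun _ => v) 0, nthProd_coeff_apply _ _ n p (fun _ => T.1 v) 0,
    nthProd_coeff_apply _ _ n (p - 1) (fun _ => v) 0]
  simp only [resDiff]
  rw [map_sub, Units.smul_def, map_zsmul, hl, hr]
  simp only [smul_sub, neg_smul, Units.smul_def, smul_comm p]
  abel

end Covariance

/-! ### The `n`-th products at the vacuum vector -/

section Vacuum

variable {K V : Type*} [NormedCommRing K] [NormedAddCommGroup V] [Module K V] [IsBoundedSMul K V]
  [IsUltrametricDist V] [CompleteSpace V]

/-- At a vector at which `a` is regular only the terms with `a` on the left survive. -/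
theorem nthProd_coeff_apply_of_isRegularAt {a : QField K V} {v : V} (ha : IsRegularAt a v)
    (b : QField K V) (n p : ℤ) : ((nthProd a b n).coeff p).1 v
      = altSum n fun j => (a.coeff (n - j)).1 ((b.coeff (p + j)).1 v) := by
  have h : ∀ j : ℕ, wordWZ a b (fun _ => v) ((0, n + p, 0) + j • (eZ - eW)) = 0 := fun j => by
    rw [add_nsmul_eZ_sub_eW, wordWZ, ha _ (by simp), map_zero]
  rw [nthProd_coeff_apply a b n p (fun _ => v) 0, resDiff]
  simp only [h, add_nsmul_eW_sub_eZ]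
  simp [altSum, wordZW]

theorem IsRegularAt.nthProd {a b : QField K V} {v : V} (ha : IsRegularAt a v)
    (hb : IsRegularAt b v) (n : ℤ) : IsRegularAt (nthProd a b n) v := fun p hp => by
  rw [nthProd_coeff_apply_of_isRegularAt ha, altSum]
  simp [fun j : ℕ => hb (p + j) (by omega)]

theorem fieldState_nthProd {a b : QField K V} {v : V} (ha : IsRegularAt a v)
    (hb : IsRegularAt b v) (n : ℤ) :
    fieldState v (nthProd a b n) = (a.coeff n).1 (fieldState v b) := by
  refine (nthProd_coeff_apply_of_isRegularAt ha b n (-1)).trans ?_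
  rw [altSum, tsum_eq_single 0]
  · rw [Nat.cast_zero, Ring.multichoose_zero_right, one_smul, sub_zero, add_zero]
    rfl
  · intro j hj
    rw [hb _ (by omega), map_zero, smul_zero]

end Vacuum

/-! ### Closed submodules of fields cut out by the axioms -/

section FieldSubmodules

variable {K V : Type*} [NormedCommRing K] [NormedAddCommGroup V] [Module K V] [IsBoundedSMul K V]

variable (K) in
/-- The fields regular at `v`. -/
def regularFields (v : V) : Submodule K (QField K V) where
  carrier := {a | IsRegularAt a v}
  zero_mem' _ _ := rfl
  add_mem' {a b} ha hb n hn := by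
    have h : ((a + b).coeff n).1 v = (a.coeff n).1 v + (b.coeff n).1 v := rfl
    rw [h, ha n hn, hb n hn, add_zero]
  smul_mem' k a ha n hn := by
    have h : ((k • a).coeff n).1 v = k • (a.coeff n).1 v := rfl
    rw [h, ha n hn, smul_zero]

theorem isClosed_regularFields (v : V) :
    IsClosed (regularFields K v : Set (QField K V)) := by
  have h : (regularFields K v : Set (QField K V))
      = ⋂ (n : ℤ) (_ : 0 ≤ n), {a | (a.coeff n).1 v = 0} := by
    ext a
    simp [regularFields, IsRegularAt]
  rw [h]
  exact isClosed_biInter fun n _ =>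
    isClosed_eq (QField.continuous_coeff_apply n v) continuous_const

theorem idField_coeff_apply (n : ℤ) (v : V) :
    ((idField K V).coeff n).1 v = if n = -1 then v else 0 := by
  have h : ((idField K V).coeff n).1 = if n = -1 then 1 else 0 := rfl
  rw [h]
  split_ifs <;> rfl

theorem isRegularAt_idField (v : V) : IsRegularAt (idField K V) v := fun n hn => by
  rw [idField_coeff_apply, if_neg (by omega)]

theorem iterate_mulZSubW (N : ℕ) (F : ℤ × ℤ → BddEnd K V) :
    mulZSubW^[N] F = (diffOp (BddEnd K V) (1, 0) (0, 1) ^ N) F := by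
  have h : mulZSubW = ⇑(diffOp (BddEnd K V) ((1, 0) : ℤ × ℤ) (0, 1)) := by
    funext F p
    simp only [mulZSubW, diffOp_apply, Prod.add_def, add_zero]
  rw [h, Module.End.pow_apply]

theorem iterate_mulZSubW_add (N : ℕ) (F H : ℤ × ℤ → BddEnd K V) :
    mulZSubW^[N] (F + H) = mulZSubW^[N] F + mulZSubW^[N] H := by
  simp only [iterate_mulZSubW, map_add]

theorem iterate_mulZSubW_smul (N : ℕ) (k : K) (F : ℤ × ℤ → BddEnd K V) :
    mulZSubW^[N] (k • F) = k • mulZSubW^[N] F := by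
  induction N with
  | zero => rfl
  | succ N ih =>
    rw [Function.iterate_succ_apply', Function.iterate_succ_apply', ih]
    funext p
    exact (smul_sub k _ _).symm

theorem comm_add_left (a b c : QField K V) : comm (a + b) c = comm a c + comm b c := by
  funext p
  refine Subtype.ext (LinearMap.ext fun v => ?_)
  change (a.coeff p.1).1 _ + (b.coeff p.1).1 _ - (c.coeff p.2).1 (_ + _) = (_ - _) + (_ - _)
  rw [map_add]
  exact add_sub_add_comm _ _ _ _

theorem comm_smul_left (k : K) (a c : QField K V) : comm (k • a) c = k • comm a c := by
  funext p
  refine Subtype.ext (LinearMap.ext fun v => ?_)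
  change k • (a.coeff p.1).1 _ - (c.coeff p.2).1 (k • _) = k • (_ - _)
  rw [map_smul, smul_sub]
  rfl

/-- The fields mutually local with `c`. -/
def localFields (c : QField K V) : Submodule K (QField K V) where
  carrier := {a | MutuallyLocal a c}
  zero_mem' := by
    refine mutuallyLocal_iff.mpr fun ε hε => ⟨0, fun N _ p => ?_⟩
    rw [← zero_smul K 0, comm_smul_left, iterate_mulZSubW_smul, zero_smul]
    simpa using hε
  add_mem' {a b} ha hb := by
    refine mutuallyLocal_iff.mpr fun ε hε => ?_
    obtain ⟨N₁, h₁⟩ := mutuallyLocal_iff.mp ha (ε / 2) (half_pos hε)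
    obtain ⟨N₂, h₂⟩ := mutuallyLocal_iff.mp hb (ε / 2) (half_pos hε)
    refine ⟨N₁ + N₂, fun N hN p => ?_⟩
    rw [comm_add_left, iterate_mulZSubW_add, Pi.add_apply, ← add_halves ε]
    exact (norm_add_le _ _).trans_lt
      (add_lt_add (h₁ N (by omega) p) (h₂ N (by omega) p))
  smul_mem' k a ha := by
    refine mutuallyLocal_iff.mpr fun ε hε => ?_
    obtain ⟨N₀, h⟩ := mutuallyLocal_iff.mp ha (ε / (‖k‖ + 1)) (by positivity)
    refine ⟨N₀, fun N hN p => ?_⟩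
    rw [comm_smul_left, iterate_mulZSubW_smul, Pi.smul_apply]
    calc ‖k • (mulZSubW^[N] (comm a c)) p‖
        ≤ (‖k‖ + 1) * ‖(mulZSubW^[N] (comm a c)) p‖ := (norm_smul_le _ _).trans
          (mul_le_mul_of_nonneg_right (by linarith) (norm_nonneg _))
      _ < (‖k‖ + 1) * (ε / (‖k‖ + 1)) :=
          mul_lt_mul_of_pos_left (h N hN p) (by positivity)
      _ = ε := by field_simp

theorem mutuallyLocal_idField (c : QField K V) : MutuallyLocal (idField K V) c := by
  refine mutuallyLocal_iff.mpr fun ε hε => ⟨0, fun N _ p => ?_⟩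
  have h : comm (idField K V) c = 0 := by
    funext p
    refine Subtype.ext (LinearMap.ext fun v => ?_)
    rw [comm_apply, idField_coeff_apply, idField_coeff_apply]
    split_ifs <;> simp
  rw [h, iterate_mulZSubW, map_zero]
  simpa using hε

variable [IsUltrametricDist V]

theorem isClosed_localFields (c : QField K V) :
    IsClosed (localFields c : Set (QField K V)) := by
  refine isClosed_of_closure_subset fun a ha => mutuallyLocal_iff.mpr fun ε hε => ?_
  obtain ⟨b, hb, hab⟩ := Metric.mem_closure_iff.mp ha (ε / 2 / (‖c‖ + 1)) (by positivity)
  obtain ⟨N₀, h⟩ := mutuallyLocal_iff.mp hb (ε / 2) (half_pos hε)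
  refine ⟨N₀, fun N hN p => ?_⟩
  rw [← sub_add_cancel a b, comm_add_left, iterate_mulZSubW_add, Pi.add_apply, ← add_halves ε]
  refine (norm_add_le _ _).trans_lt (add_lt_add_of_le_of_lt ?_ (h N hN p))
  refine (norm_le_of_forall (by positivity) (iterate_mulZSubW_norm_le (a - b) c N p)).trans ?_
  rw [dist_eq_norm] at hab
  calc ‖a - b‖ * ‖c‖ ≤ ε / 2 / (‖c‖ + 1) * (‖c‖ + 1) := by
        gcongr
        linarith
    _ = ε / 2 := by field_simp

/-- The fields translation covariant with respect to `T`. -/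
def covariantFields (T : BddEnd K V) : Submodule K (QField K V) where
  carrier := {a | TranslationCovariant T a}
  zero_mem' := translationCovariant_iff.mpr fun n v => by
    have h : ∀ n v, ((0 : QField K V).coeff n).1 v = 0 := fun _ _ => rfl
    simp [h]
  add_mem' {a b} ha hb := translationCovariant_iff.mpr fun n v => by
    have h : ∀ n v, ((a + b).coeff n).1 v = (a.coeff n).1 v + (b.coeff n).1 v := fun _ _ => rfl
    rw [h, h, h, map_add, smul_add, ← translationCovariant_iff.mp ha n v,
      ← translationCovariant_iff.mp hb n v]
    abel
  smul_mem' k a ha := translationCovariant_iff.mpr fun n v => by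
    have h : ∀ n v, ((k • a).coeff n).1 v = k • (a.coeff n).1 v := fun _ _ => rfl
    rw [h, h, h, map_smul, smul_comm _ k, ← translationCovariant_iff.mp ha n v, smul_sub]

theorem isClosed_covariantFields (T : BddEnd K V) :
    IsClosed (covariantFields T : Set (QField K V)) := by
  have h : (covariantFields T : Set (QField K V)) = ⋂ (n : ℤ) (v : V), {a |
      T.1 ((a.coeff n).1 v) - (a.coeff n).1 (T.1 v) = -n • (a.coeff (n - 1)).1 v} := by
    ext a
    simp only [Set.mem_iInter]
    exact translationCovariant_iff
  rw [h]
  exact isClosed_iInter fun n => isClosed_iInter fun v => isClosed_eq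
    (((continuous_bddEnd T).comp (QField.continuous_coeff_apply n v)).sub
      (QField.continuous_coeff_apply n _))
    ((QField.continuous_coeff_apply (n - 1) v).const_smul (-n))

theorem translationCovariant_idField (T : BddEnd K V) :
    TranslationCovariant T (idField K V) := by
  refine translationCovariant_iff.mpr fun n v => ?_
  simp only [idField_coeff_apply]
  rcases eq_or_ne n 0 with rfl | hn
  · simp
  · rw [if_neg (show n - 1 ≠ -1 by omega)]
    split_ifs <;> simp

end FieldSubmodules

/-! ### Pairwise local families -/

section LocalClosure

variable {K V : Type*} [NormedCommRing K] [NormedAddCommGroup V] [Module K V] [IsBoundedSMul K V]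
  {J : Type*} {a : J → QField K V} {φ ψ : QField K V}

/-- The fields local with every field that is local with all members of the family: the bicommutant
of the family for the relation of mutual locality. -/
noncomputable def localClosure (a : J → QField K V) : Submodule K (QField K V) :=
  ⨅ (c : QField K V) (_ : ∀ j, MutuallyLocal c (a j)), localFields c

theorem mem_localClosure :
    φ ∈ localClosure a ↔ ∀ c, (∀ j, MutuallyLocal c (a j)) → MutuallyLocal φ c := by
  simp only [localClosure, Submodule.mem_iInf]
  rfl

/-- As the members of the family commute with each other in the sense of locality, so do those of its
bicommutant. -/
theorem mutuallyLocal_of_mem_localClosure (hloc : ∀ i j, MutuallyLocal (a i) (a j))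
    (hφ : φ ∈ localClosure a) (hψ : ψ ∈ localClosure a) : MutuallyLocal φ ψ :=
  mem_localClosure.mp hφ ψ fun j => mem_localClosure.mp hψ (a j) fun i => hloc j i

end LocalClosure

/-! ### Fields generated by a family -/

section Extension

variable {K V : Type*} [NormedCommRing K] [NormedAddCommGroup V] [Module K V] [IsBoundedSMul K V]
  [IsUltrametricDist V] [CompleteSpace V]

theorem closure_generatedFields_le {J : Type*} {a : J → QField K V}
    {S : Submodule K (QField K V)} (hS : IsClosed (S : Set (QField K V))) (ha : ∀ j, a j ∈ S)
    (hid : idField K V ∈ S) (hn : ∀ φ ∈ S, ∀ ψ ∈ S, ∀ n : ℤ, nthProd φ ψ n ∈ S) :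
    (generatedFields a).topologicalClosure ≤ S :=
  Submodule.topologicalClosure_minimal _ (sInf_le ⟨ha, hid, hn⟩) hS

theorem nthProd_mem_generatedFields {J : Type*} {a : J → QField K V} {φ ψ : QField K V}
    (hφ : φ ∈ generatedFields a) (hψ : ψ ∈ generatedFields a) (n : ℤ) :
    nthProd φ ψ n ∈ generatedFields a :=
  Submodule.mem_sInf.mpr fun S hS => hS.2.2 φ (Submodule.mem_sInf.mp hφ S hS) ψ
    (Submodule.mem_sInf.mp hψ S hS) n

end Extension

end NonArchVertex

theorem theorem3 {K V : Type*}
    [NormedCommRing K] [IsUltrametricDist K] [CompleteSpace K] [IsAddTorsionFree K]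
    [NormedAddCommGroup V] [IsUltrametricDist V] [CompleteSpace V] [IsAddTorsionFree V]
    [Module K V] [IsBoundedSMul K V]
    (torsionFree : ∀ (c : K) (v : V), c • v = 0 → c = 0 ∨ v = 0)
    (vac : V) (T : NonArchVertex.BddEnd K V) {J : Type*} (a : J → NonArchVertex.QField K V)
    (hT : T.1 vac = 0)
    (hvac : ∀ j, NonArchVertex.IsRegularAt (a j) vac)
    (htrans : ∀ j, NonArchVertex.TranslationCovariant T (a j))
    (hloc : ∀ i j, NonArchVertex.MutuallyLocal (a i) (a j))
    (hcompl : Dense (NonArchVertex.saturation (NonArchVertex.generatedStates a vac))) :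
    ∃ A : NonArchVertex.VertexAlgebra K V, A.vac = vac ∧ A.T = T ∧
      (A.fld : Set (NonArchVertex.QField K V)) = closure (NonArchVertex.generatedFields a : Set (NonArchVertex.QField K V)) := by
  open NonArchVertex in
  set fld := (generatedFields a).topologicalClosure with hfld
  have ha : ∀ j, a j ∈ fld := fun j =>
    Submodule.le_topologicalClosure _ (Submodule.mem_sInf.mpr fun S hS => hS.1 j)
  have hid : idField K V ∈ fld :=
    Submodule.le_topologicalClosure _ (Submodule.mem_sInf.mpr fun S hS => hS.2.1)
  have hprod : ∀ φ ∈ fld, ∀ ψ ∈ fld, ∀ n : ℤ, nthProd φ ψ n ∈ fld := fun φ hφ ψ hψ n =>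
    map_mem_closure₂ (f := fun φ ψ => nthProd φ ψ n) (continuous_nthProd n) hφ hψ fun _ h _ h' =>
      nthProd_mem_generatedFields h h' n
  have hreg : fld ≤ regularFields K vac :=
    closure_generatedFields_le (isClosed_regularFields vac) hvac (isRegularAt_idField vac)
      fun _ h _ h' n => IsRegularAt.nthProd h h' n
  have hcov : fld ≤ covariantFields T :=
    closure_generatedFields_le (isClosed_covariantFields T) htrans (translationCovariant_idField T)
      fun _ h _ h' n => TranslationCovariant.nthProd h h' n
  have hlocal : fld ≤ localClosure a := by
    refine closure_generatedFields_le ?_ (fun j => mem_localClosure.mpr fun c hc => (hc j).symm)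
      (mem_localClosure.mpr fun c _ => mutuallyLocal_idField c) fun φ hφ ψ hψ n =>
        mem_localClosure.mpr fun c hc => ?_
    · simp only [localClosure, Submodule.coe_iInf]
      exact isClosed_iInter fun c => isClosed_iInter fun _ => isClosed_localFields c
    · exact (mutuallyLocal_of_mem_localClosure hloc hφ hψ).nthProd_left
        (mem_localClosure.mp hφ c hc) (mem_localClosure.mp hψ c hc) n
  have hstates : generatedStates a vac ≤ fld.map (fieldState vac) := by
    refine sInf_le ⟨⟨idField K V, hid, 
      (idField_coeff_apply (K := K) (-1) vac).trans (if_pos rfl)⟩, ?_⟩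
    rintro j n _ ⟨φ, hφ, rfl⟩
    exact ⟨nthProd (a j) φ n, hprod _ (ha j) φ hφ n, fieldState_nthProd (hvac j) (hreg hφ) n⟩
  exact ⟨{ ring_torsionFree := inferInstance
           add_torsionFree := inferInstance
           torsionFree := torsionFree
           vac := vac
           T := T
           T_vac := hT
           fld := fld
           fld_closed := Submodule.isClosed_topologicalClosure _
           id_mem := hid
           vacuum := fun _ h => hreg h
           translation := fun _ h => hcov h
           locality := fun _ h _ h' => mutuallyLocal_of_mem_localClosure hloc (hlocal h) (hlocal h')
           nthProd_mem := hprod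
           completeness := hcompl.mono fun _ hv =>
             hv.imp fun _ hc => ⟨hc.1, hstates hc.2⟩ },
    rfl, rfl, rfl⟩
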